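/- Let $G=(V,A)$ be a finite directed graph with $n=|V|$ and $m=|A|$ that is bi-directed (for every arc $a=u\to v$ in $A$ the reversed arc $\bar a=v\to u$ is also in $A$) and connected, and let $r\in V$ be a root. Each arc $a$ has a failure probability $p_a$ with $p_a=p_{\bar a}$ and $0<p_a\le p_{\max}<1$. A subgraph $S\subseteq A$ is root-connected if $(V,S)$ contains a directed path from every vertex to $r$; its weight is $\mathrm{wt}(S)=\prod_{a\in S}(1-p_a)\prod_{a\in A\setminus S}p_a$. A cluster of $S$ is a non-empty set $C\subseteq V\setminus\{r\}$ such that no arc of $S$ goes from $C$ to $V\setminus C$; it is minimal if no proper subset of it is a cluster. Cluster-popping is the following algorithm. Draw $S\subseteq A$ by including each arc $a$ independently with probability $1-p_a$. While $S$ has a cluster, let $C_1,\dots,C_k$ be all minimal clusters of $S$, and independently redraw (arc $a$ being present with probability $1-p_a$) all arcs of $A$ whose tail lies in $C_1\cup\dots\cup C_k$, keeping all other arcs as they are. Return $S$. Then cluster-popping terminates almost surely, its output is distributed over the root-connected subgraphs with probability proportional to $\mathrm{wt}$, and the expected number of random variables it draws (the $m$ initial draws plus one for each arc redrawn in each iteration)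 is at most $$m+\frac{p_{\max}\,m\,n}{1-p_{\max}}.$$ This bound is tight in the following sense. Fix $0<p<1$ and $0<\varepsilon<1$. For an integer $n_2\ge 1$ put $n_1=\lceil n_2^{1+\varepsilon}\rceil$, and let $G_{n_2}$ be the bi-directed lollipop graph consisting of a path with $n_1$ edges attached at one of its end vertices to a clique on $n_2$ vertices (that end vertex is one of the $n_2$ vertices of the clique, and each undirected edge is replaced by its two arcs), with the root at the other end of the path and $p_a=p$ for every arc. With $n=n_1+n_2$ the number of vertices and $m$ the number of arcs of $G_{n_2}$, the expected number of random variables that cluster-popping draws on $G_{n_2}$ equals $$m+(1-o(1))\,\frac{p\,m\,n}{1-p}\qquad\text{as } n_2\to\infty .$$ -/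

import Mathlib

open MeasureTheory Filter Topology
open scoped ENNReal

noncomputable section

namespace ClusterPopping

/-- The arcs `src → tgt` of a directed graph `G = (V, A)`; the type `Arc G` is the arc set `A`. -/
@[ext]
structure Arc {V : Type*} (G : Digraph V) where
  src : V
  tgt : V
  adj : G.Adj src tgt

instance Arc.instFinite {V : Type*} [Finite V] (G : Digraph V) : Finite (Arc G) :=
  Finite.of_injective (fun a : Arc G => (a.src, a.tgt)) (fun a b h => by
    simp only [Prod.mk.injEq] at h
    exact Arc.ext h.1 h.2)

instance Arc.instFintype {V : Type*} [Finite V] (G : Digraph V) : Fintype (Arc G) :=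
  Fintype.ofFinite _

/-- Each arc has an anti-parallel twin. -/
def IsBidirected {V : Type*} (G : Digraph V) : Prop :=
  ∀ u v, G.Adj u v → G.Adj v u

section Subgraphs

variable {V : Type*} {G : Digraph V}

/-- There is a directed path from `u` to `v` in the subgraph `(V, S)`. -/
def Reaches (S : Finset (Arc G)) (u v : V) : Prop :=
  Relation.ReflTransGen (fun x y => ∃ a ∈ S, a.src = x ∧ a.tgt = y) u v

/-- In `(V, S)` every vertex has a directed path to the root `r`. -/
def RootConnected (r : V) (S : Finset (Arc G)) : Prop :=
  ∀ v, Reaches S v r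

/-- A cluster of `(V, S)`: a non-empty set of vertices not containing the root,
with no arc of `S` going out of it. -/
def IsCluster (r : V) (S : Finset (Arc G)) (C : Set V) : Prop :=
  C.Nonempty ∧ r ∉ C ∧ ∀ a ∈ S, a.src ∈ C → a.tgt ∈ C

/-- A cluster none of whose proper subsets is a cluster; this is the bad event `B_C`. -/
def IsMinimalCluster (r : V) (S : Finset (Arc G)) (C : Set V) : Prop :=
  IsCluster r S C ∧ ∀ C' : Set V, C' ⊂ C → ¬ IsCluster r S C'

/-- The `while` condition of cluster-popping. -/
def HasCluster (r : V) (S : Finset (Arc G)) : Prop :=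
  ∃ C : Set V, IsCluster r S C

variable [Finite V]

open Classical in
/-- `vbl(B_C)`: the arcs of `G` (present in the current subgraph or not) whose tail lies in `C`. -/
def vbl (G : Digraph V) (C : Set V) : Finset (Arc G) :=
  Finset.univ.filter fun a => a.src ∈ C

open Classical in
/-- The union of `vbl(B_C)` over all minimal clusters `C` of `(V, S)`: the arcs that one round of
cluster-popping re-randomizes. It is empty when there is no cluster. -/
def resampled (r : V) (S : Finset (Arc G)) : Finset (Arc G) :=
  Finset.univ.filter fun a => ∃ C : Set V, IsMinimalCluster r S C ∧ a ∈ vbl G C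

open Classical in
/-- The weight `∏_{a ∈ S} (1 - p_a) ∏_{a ∉ S} p_a` of a subgraph. -/
def wt (p : Arc G → ℝ) (S : Finset (Arc G)) : ℝ :=
  ∏ a : Arc G, if a ∈ S then 1 - p a else p a

open Classical in
/-- The target distribution: proportional to the weight on root-connected subgraphs, and zero on
all other subgraphs. -/
def target (r : V) (p : Arc G → ℝ) (S : Finset (Arc G)) : ℝ :=
  if RootConnected r S then
    wt p S / ∑ S' ∈ Finset.univ.filter (fun S' : Finset (Arc G) => RootConnected r S'), wt p S'
  else 0

end Subgraphs

section Algorithm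

variable {V : Type*} [Finite V] {G : Digraph V}

/-- One draw of the variable of an arc with failure probability `q`:
present (`true`) with probability `1 - q`, absent (`false`) with probability `q`. -/
def arcLaw (q : ℝ) : Measure Bool :=
  ENNReal.ofReal (1 - q) • Measure.dirac true + ENNReal.ofReal q • Measure.dirac false

/-- The source of randomness: `ω t a` is the fresh sample available for arc `a` in round `t`; all
these samples are independent, and `ω t a` has the law of the variable of `a`. -/
def drawMeasure (p : Arc G → ℝ) : Measure (ℕ → Arc G → Bool) :=
  Measure.infinitePi fun _ : ℕ => Measure.pi fun a : Arc G => arcLaw (p a)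

open Classical in
/-- The subgraph `S` held by cluster-popping after `t` rounds. Round `0` draws all arcs; round
`t + 1` re-randomizes the arcs in `⋃ vbl(B_C)` over the minimal clusters `C` of the current
subgraph and keeps all others. Once there is no cluster the subgraph never changes again. -/
def state (r : V) (ω : ℕ → Arc G → Bool) : ℕ → Finset (Arc G)
  | 0 => Finset.univ.filter fun a => ω 0 a = true
  | t + 1 => Finset.univ.filter fun a =>
      if a ∈ resampled r (state r ω t) then ω (t + 1) a = true else a ∈ state r ω t

/-- The `while` loop terminates and returns `S`. -/
def Returns (r : V) (ω : ℕ → Arc G → Bool) (S : Finset (Arc G)) : Prop :=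
  ∃ t, (∀ s < t, HasCluster r (state r ω s)) ∧ ¬ HasCluster r (state r ω t) ∧ state r ω t = S

/-- The number of random variables drawn in the run `ω`: one for each arc at the start, then one
for each arc re-randomized in each round (none once the loop has ended). -/
def draws (r : V) (ω : ℕ → Arc G → Bool) : ℝ≥0∞ :=
  (Nat.card (Arc G) : ℝ≥0∞) + ∑' t, ((resampled r (state r ω t)).card : ℝ≥0∞)

/-- The expected number of random variables drawn by cluster-popping. -/
def expectedDraws (r : V) (p : Arc G → ℝ) : ℝ≥0∞ :=
  ∫⁻ ω, draws r ω ∂(drawMeasure p)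

end Algorithm

/-- The bi-directed lollipop: the simple path `0, 1, …, n₁` of length `n₁` attached at its end
vertex `n₁` to the clique on the `n₂` vertices `n₁, …, n₁ + n₂ - 1`. -/
def lollipop (n₁ n₂ : ℕ) : Digraph (Fin (n₁ + n₂)) where
  Adj u v := u ≠ v ∧
    ((u : ℕ) + 1 = v ∨ (v : ℕ) + 1 = u ∨ (n₁ ≤ (u : ℕ) ∧ n₁ ≤ (v : ℕ)))

/-- The path length `⌈n₂ ^ (1 + ε)⌉` used with a clique of size `n₂`. -/
def pathLength (ε : ℝ) (n₂ : ℕ) : ℕ := ⌈(n₂ : ℝ) ^ (1 + ε)⌉₊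

end ClusterPopping

end

/-! Minimal clusters are pairwise disjoint, and whether a set is a minimal cluster depends only on
the arcs with tail in it. Hence "the popped set is `W`, and every cluster meets the previously
popped `W'`" splits into `Block r W' W`, which sees only arcs out of `W`, and `Meets r W`, which
sees only the other arcs (`popped_eq_iff`). Popping redraws exactly the arcs seen by the first
event, so after a history ending with `W` the state has the original product weights restricted to
`Meets r W`. This gives the closed form `occupation` for the law of the running loop. On a subgraph
without clusters the restriction is void, so every root-connected subgraph is returned with
probability proportional to its weight.

Summing over histories telescopes. With `Z = prob p (Meets r ∅)`, the weight of the root-connected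
subgraphs, the total weight of histories is `1 / Z` (`hasSum_layer`), and the expected number of
rounds that pop `v` is `prob p (AllThrough r v ∅) / Z` (`hasSum_occupation_popped`), where
`AllThrough r v ∅` says that clusters exist and all contain `v`. Summing over tails of arcs yields
the exact cost, `expectedDraws_eq`.

For the upper bound, a subgraph with all clusters through `v` is repaired
(`AllThrough.exists_repair`): choose an arc `a` leaving the set of vertices that miss the root,
reverse all arcs inside the set reachable from its tail, and add `a`. The result is root-connected,
`a` separates `v` from the root in it, and the original can be recovered from the result together
with `a`. The weight ratio is `p a / (1 - p a)`. Cut arcs have distinct tails, so at most `n` arcs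
are possible per repaired subgraph.

On the lollipop, take `v` in the clique. Breaking the path at any one of its `n₁` edges, with the
arcs below leading down and those above leading up, forces all clusters through `v` once the clique
is connected in two steps. These disjoint events give at least `n₁ q / (1 - q)` times a probability
tending to one (`le_prob_allThrough_div`). Since `ε > 0`, the path has almost all the vertices;
since `ε < 1`, the clique has almost all the arcs. -/

namespace ClusterPopping

noncomputable section

set_option linter.unusedSectionVars false

/-! ### Finite product weights and independence of events on disjoint sets of arcs. -/

section ProductWeight

open Classical in
/-- The indicator of a proposition, as a real number. -/
def ind (P : Prop) : ℝ := if P then 1 else 0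

lemma ind_of_true {P : Prop} (h : P) : ind P = 1 := by simp [ind, h]

lemma ind_of_false {P : Prop} (h : ¬ P) : ind P = 0 := by simp [ind, h]

lemma ind_nonneg (P : Prop) : 0 ≤ ind P := by unfold ind; split_ifs <;> norm_num

lemma ind_le_one (P : Prop) : ind P ≤ 1 := by unfold ind; split_ifs <;> norm_num

lemma ind_and (P Q : Prop) : ind (P ∧ Q) = ind P * ind Q := by
  unfold ind; by_cases P <;> by_cases Q <;> simp [*]

lemma ind_not (P : Prop) : ind (¬ P) = 1 - ind P := by
  unfold ind; by_cases P <;> simp [*]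

lemma ind_mono {P Q : Prop} (h : P → Q) : ind P ≤ ind Q := by
  by_cases hP : P
  · rw [ind_of_true hP, ind_of_true (h hP)]
  · rw [ind_of_false hP]; exact ind_nonneg Q

lemma ind_congr {P Q : Prop} (h : P ↔ Q) : ind P = ind Q := by rw [propext h]

lemma sum_ind_eq {ι : Type*} [Fintype ι] (i : ι) (f : ι → ℝ) :
    ∑ j, ind (i = j) * f j = f i := by
  classical
  simp [ind]

variable {V : Type*} [Fintype V] {G : Digraph V}

/-- The probability of the event `E` for a random subgraph drawn with the weights `wt p`. -/
def prob (p : Arc G → ℝ) (E : Finset (Arc G) → Prop) : ℝ :=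
  ∑ S, wt p S * ind (E S)

/-- The subgraph that agrees with `S` on `X` and with `T` off `X`. -/
def merge (X : Set (Arc G)) (S T : Finset (Arc G)) : Finset (Arc G) := by
  classical exact Finset.univ.filter fun a => if a ∈ X then a ∈ S else a ∈ T

/-- The event `E` depends only on the arcs in `X`. -/
def LocalOn (X : Set (Arc G)) (E : Finset (Arc G) → Prop) : Prop :=
  ∀ S T, (∀ a ∈ X, a ∈ S ↔ a ∈ T) → (E S ↔ E T)

variable {p : Arc G → ℝ} {X : Set (Arc G)}

lemma mem_merge {S T : Finset (Arc G)} {a : Arc G} :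
    a ∈ merge X S T ↔ (a ∈ X ∧ a ∈ S) ∨ (a ∉ X ∧ a ∈ T) := by
  unfold merge
  by_cases h : a ∈ X <;> simp [h]

lemma LocalOn.merge_left {E : Finset (Arc G) → Prop} (h : LocalOn X E) (S T : Finset (Arc G)) :
    E (merge X S T) ↔ E S :=
  h _ _ fun a ha => by simp [mem_merge, ha]

lemma LocalOn.merge_right {E : Finset (Arc G) → Prop} (h : LocalOn Xᶜ E)
    (S T : Finset (Arc G)) : E (merge X S T) ↔ E T :=
  h _ _ fun a ha => by
    have : a ∉ X := ha
    simp [mem_merge, this]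

lemma merge_merge (S T : Finset (Arc G)) : merge X (merge X S T) (merge X T S) = S := by
  ext a; by_cases h : a ∈ X <;> simp [mem_merge, h]

lemma wt_eq (p : Arc G → ℝ) (S : Finset (Arc G)) :
    wt p S = ∏ a, (ind (a ∈ S) * (1 - p a) + ind (a ∉ S) * p a) := by
  unfold wt
  refine Finset.prod_congr rfl fun a _ => ?_
  by_cases h : a ∈ S <;> simp [h, ind]

lemma wt_merge_mul (S T : Finset (Arc G)) :
    wt p (merge X S T) * wt p (merge X T S) = wt p S * wt p T := by
  simp only [wt_eq]
  rw [← Finset.prod_mul_distrib, ← Finset.prod_mul_distrib]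
  refine Finset.prod_congr rfl fun a _ => ?_
  by_cases h : a ∈ X <;> simp [mem_merge, h, mul_comm]

/-- Exchanging the coordinates in `X` between two independent copies is a weight-preserving
involution. Both independence and the resampling step follow from this. -/
lemma sum_swap (X : Set (Arc G)) (F : Finset (Arc G) → Finset (Arc G) → ℝ) :
    ∑ S, ∑ T, wt p S * wt p T * F (merge X S T) (merge X T S)
      = ∑ S, ∑ T, wt p S * wt p T * F S T := by
  rw [← Finset.sum_product', ← Finset.sum_product']
  let e : Finset (Arc G) × Finset (Arc G) → Finset (Arc G) × Finset (Arc G) :=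
    fun x => (merge X x.1 x.2, merge X x.2 x.1)
  have he : Function.Involutive e := fun x => by simp [e, merge_merge]
  refine Finset.sum_bijective e he.bijective (by simp) fun x _ => ?_
  simp only [e, wt_merge_mul]

lemma sum_prod_ite (f g : Arc G → ℝ) :
    ∑ S : Finset (Arc G), ((∏ a, (ind (a ∈ S) * f a + ind (a ∉ S) * g a)))
      = ∏ a, (f a + g a) := by
  classical
  rw [Finset.prod_add]
  rw [Finset.powerset_univ]
  refine Finset.sum_congr rfl fun S _ => ?_
  rw [← Finset.prod_sdiff (Finset.subset_univ S), mul_comm]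
  congr 1
  · exact Finset.prod_congr rfl fun a ha => by simp [ind, ha]
  · refine Finset.prod_congr rfl fun a ha => ?_
    have : a ∉ S := (Finset.mem_sdiff.1 ha).2
    simp [ind, this]

/-- The probability that all arcs of `L` are present and all arcs of `M` are absent. -/
lemma prob_pattern (p : Arc G → ℝ) (L M : Finset (Arc G)) (hLM : Disjoint L M) :
    prob p (fun S => (∀ a ∈ L, a ∈ S) ∧ ∀ a ∈ M, a ∉ S)
      = (∏ a ∈ L, (1 - p a)) * ∏ a ∈ M, p a := by
  classical
  have key := sum_prod_ite (fun a => ind (a ∉ M) * (1 - p a)) (fun a => ind (a ∉ L) * p a)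
  have h1 : prob p (fun S => (∀ a ∈ L, a ∈ S) ∧ ∀ a ∈ M, a ∉ S)
      = ∑ S : Finset (Arc G), ∏ a, (ind (a ∈ S) * (ind (a ∉ M) * (1 - p a))
          + ind (a ∉ S) * (ind (a ∉ L) * p a)) := by
    refine Finset.sum_congr rfl fun S _ => ?_
    by_cases h : (∀ a ∈ L, a ∈ S) ∧ ∀ a ∈ M, a ∉ S
    · rw [ind_of_true h, mul_one, wt_eq]
      refine Finset.prod_congr rfl fun a _ => ?_
      by_cases ha : a ∈ S
      · have : a ∉ M := fun h' => h.2 a h' ha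
        simp [ind, ha, this]
      · have : a ∉ L := fun h' => ha (h.1 a h')
        simp [ind, ha, this]
    · rw [ind_of_false h, mul_zero]
      symm
      rw [not_and_or] at h
      push Not at h
      rcases h with ⟨a, haL, haS⟩ | ⟨a, haM, haS⟩
      · exact Finset.prod_eq_zero (Finset.mem_univ a) (by simp [ind, haL, haS])
      · exact Finset.prod_eq_zero (Finset.mem_univ a) (by simp [ind, haM, haS])
  rw [h1, key]
  have h2 : ∀ a, ind (a ∉ M) * (1 - p a) + ind (a ∉ L) * p a
      = (if a ∈ L then 1 - p a else 1) * (if a ∈ M then p a else 1) := by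
    intro a
    by_cases hL : a ∈ L
    · have hM : a ∉ M := Finset.disjoint_left.1 hLM hL
      simp [ind, hL, hM]
    · by_cases hM : a ∈ M <;> simp [ind, hL, hM]
  simp_rw [h2, Finset.prod_mul_distrib]
  simp [Finset.prod_ite_mem]

lemma prob_true (p : Arc G → ℝ) : prob p (fun _ => True) = 1 := by
  have := prob_pattern p ∅ ∅ (by simp)
  simpa using this

lemma sum_wt (p : Arc G → ℝ) : ∑ S, wt p S = 1 := by
  have := prob_true p
  simpa [prob, ind] using this

lemma prob_congr {E F : Finset (Arc G) → Prop} (h : ∀ S, E S ↔ F S) : prob p E = prob p F := by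
  rw [show E = F from funext fun S => propext (h S)]

/-- After the swap of `sum_swap`, `E` reads the first copy and `F` the second, so the double sum
factors. -/
lemma prob_and {E F : Finset (Arc G) → Prop} (hE : LocalOn X E) (hF : LocalOn Xᶜ F) :
    prob p (fun S => E S ∧ F S) = prob p E * prob p F := by
  have := sum_swap (p := p) X fun S _ => ind (E S ∧ F S)
  simp only [hE.merge_left, hF.merge_right] at this
  have h2 : ∑ S, ∑ T, wt p S * wt p T * ind (E S ∧ F S) = prob p (fun S => E S ∧ F S) := by
    refine Finset.sum_congr rfl fun S _ => ?_
    rw [← Finset.sum_mul, ← Finset.mul_sum, sum_wt, mul_one]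
  rw [h2] at this
  rw [← this, prob, prob, Finset.sum_mul_sum]
  refine Finset.sum_congr rfl fun S _ => Finset.sum_congr rfl fun T _ => ?_
  rw [ind_and]; ring

/-- All failure probabilities lie in the unit interval. -/
def UnitRange (p : Arc G → ℝ) : Prop := ∀ a, 0 ≤ p a ∧ p a ≤ 1

lemma wt_nonneg (hp : UnitRange p) (S : Finset (Arc G)) : 0 ≤ wt p S := by
  refine Finset.prod_nonneg fun a _ => ?_
  split_ifs
  · linarith [(hp a).2]
  · exact (hp a).1

lemma prob_nonneg (hp : UnitRange p) (E : Finset (Arc G) → Prop) : 0 ≤ prob p E :=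
  Finset.sum_nonneg fun S _ => mul_nonneg (wt_nonneg hp S) (ind_nonneg _)

lemma prob_mono (hp : UnitRange p) {E F : Finset (Arc G) → Prop} (h : ∀ S, E S → F S) :
    prob p E ≤ prob p F :=
  Finset.sum_le_sum fun S _ => mul_le_mul_of_nonneg_left (ind_mono (h S)) (wt_nonneg hp S)

lemma prob_le_one (hp : UnitRange p) (E : Finset (Arc G) → Prop) : prob p E ≤ 1 :=
  (prob_mono hp fun _ _ => trivial).trans_eq (prob_true p)

lemma prob_not (E : Finset (Arc G) → Prop) : prob p (fun S => ¬ E S) = 1 - prob p E := by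
  simp only [prob, ind_not, mul_sub, mul_one, Finset.sum_sub_distrib, sum_wt]

lemma prob_exists_le (hp : UnitRange p) {ι : Type*} (s : Finset ι)
    (E : ι → Finset (Arc G) → Prop) :
    prob p (fun S => ∃ i ∈ s, E i S) ≤ ∑ i ∈ s, prob p (E i) := by
  simp only [prob]
  rw [Finset.sum_comm]
  refine Finset.sum_le_sum fun S _ => ?_
  rw [← Finset.mul_sum]
  refine mul_le_mul_of_nonneg_left ?_ (wt_nonneg hp S)
  by_cases h : ∃ i ∈ s, E i S
  · obtain ⟨i, hi, hS⟩ := h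
    calc ind (∃ i ∈ s, E i S) ≤ ind (E i S) := by rw [ind_of_true hS]; exact ind_le_one _
      _ ≤ _ := Finset.single_le_sum (f := fun i => ind (E i S)) (fun j _ => ind_nonneg _) hi
  · rw [ind_of_false h]
    exact Finset.sum_nonneg fun _ _ => ind_nonneg _

lemma sum_prob_le (hp : UnitRange p) {ι : Type*} (s : Finset ι)
    (E : ι → Finset (Arc G) → Prop) (F : Finset (Arc G) → Prop)
    (hEF : ∀ i ∈ s, ∀ S, E i S → F S)
    (hdisj : ∀ i ∈ s, ∀ j ∈ s, ∀ S, E i S → E j S → i = j) :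
    ∑ i ∈ s, prob p (E i) ≤ prob p F := by
  simp only [prob]
  rw [Finset.sum_comm]
  refine Finset.sum_le_sum fun S _ => ?_
  rw [← Finset.mul_sum]
  refine mul_le_mul_of_nonneg_left ?_ (wt_nonneg hp S)
  by_cases h : ∃ i ∈ s, E i S
  · obtain ⟨i, hi, hS⟩ := h
    rw [Finset.sum_eq_single_of_mem i hi fun j hj hne => ind_of_false fun hj' =>
      hne (hdisj j hj i hi S hj' hS)]
    exact ind_mono (hEF i hi S)
  · push Not at h
    rw [Finset.sum_eq_zero fun i hi => ind_of_false (h i hi)]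
    exact ind_nonneg _

end ProductWeight

/-! ### Minimal clusters and the factorization of the popping event. -/

section Clusters

variable {V : Type*} [Fintype V] {G : Digraph V} {r v : V} {S T : Finset (Arc G)}
  {C D W W' : Set V}

lemma IsCluster.exists_minimal_subset (h : IsCluster r S C) :
    ∃ D ⊆ C, IsMinimalCluster r S D := by
  obtain ⟨D, hDC, hD⟩ := (Set.toFinite {D : Set V | IsCluster r S D}).exists_le_minimal h
  exact ⟨D, hDC, hD.prop, fun C' hC' h' => hC'.2 (hD.le_of_le h' hC'.1)⟩

lemma IsCluster.inter (hC : IsCluster r S C) (hD : IsCluster r S D) (h : (C ∩ D).Nonempty) :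
    IsCluster r S (C ∩ D) :=
  ⟨h, fun hr => hC.2.1 hr.1, fun a ha hs => ⟨hC.2.2 a ha hs.1, hD.2.2 a ha hs.2⟩⟩

lemma IsMinimalCluster.subset (hC : IsMinimalCluster r S C) (hD : IsCluster r S D)
    (h : (C ∩ D).Nonempty) : C ⊆ D := by
  by_contra hCD
  exact hC.2 (C ∩ D) ⟨Set.inter_subset_left, fun h' => hCD fun x hx => (h' hx).2⟩
    (hC.1.inter hD h)

/-- A non-empty intersection of clusters is a cluster, so distinct minimal clusters are disjoint. -/
lemma IsMinimalCluster.eq (hC : IsMinimalCluster r S C) (hD : IsMinimalCluster r S D)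
    (h : (C ∩ D).Nonempty) : C = D :=
  (hC.subset hD.1 h).antisymm (hD.subset hC.1 (by rwa [Set.inter_comm]))

/-- The vertices in minimal clusters. -/
def popped (r : V) (S : Finset (Arc G)) : Set V :=
  {v | ∃ C, IsMinimalCluster r S C ∧ v ∈ C}

/-- The arcs with tail in `W`. -/
def outArcs (G : Digraph V) (W : Set V) : Set (Arc G) := {a | a.src ∈ W}

/-- Every cluster of `S` intersects `W`. -/
def Meets (r : V) (W : Set V) (S : Finset (Arc G)) : Prop :=
  ∀ C, IsCluster r S C → (C ∩ W).Nonempty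

/-- `W` is a union of minimal clusters of `S`, all of which intersect `W'`. -/
def Block (r : V) (W' W : Set V) (S : Finset (Arc G)) : Prop :=
  ∀ x ∈ W, ∃ C, IsMinimalCluster r S C ∧ x ∈ C ∧ C ⊆ W ∧ (C ∩ W').Nonempty

/-- There is a cluster disjoint from `W`, and all such clusters contain `v`. -/
def AllThrough (r v : V) (W : Set V) (S : Finset (Arc G)) : Prop :=
  ¬ Meets r W S ∧ ∀ C, IsCluster r S C → Disjoint C W → v ∈ C

lemma hasCluster_iff : HasCluster r S ↔ popped r S ≠ ∅ := by
  rw [← Set.nonempty_iff_ne_empty]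
  constructor
  · rintro ⟨C, hC⟩
    obtain ⟨D, -, hD⟩ := hC.exists_minimal_subset
    obtain ⟨x, hx⟩ := hD.1.1
    exact ⟨x, D, hD, hx⟩
  · rintro ⟨x, C, hC, -⟩
    exact ⟨C, hC.1⟩

lemma mem_vbl {a : Arc G} : a ∈ vbl G C ↔ a.src ∈ C := by
  refine (@Finset.mem_filter _ _ (fun _ => Classical.propDecidable _) _ _).trans ?_
  exact ⟨fun h => h.2, fun h => ⟨Finset.mem_univ a, h⟩⟩

lemma mem_resampled {a : Arc G} : a ∈ resampled r S ↔ a.src ∈ popped r S := by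
  refine (@Finset.mem_filter _ _ (fun _ => Classical.propDecidable _) _ _).trans ?_
  simp only [Finset.mem_univ, true_and, mem_vbl]
  exact Iff.rfl

lemma meets_empty : Meets r ∅ S ↔ ¬ HasCluster r S := by
  simp [Meets, HasCluster]

lemma meets_univ : Meets r Set.univ S := fun C hC => by simpa using hC.1

lemma meets_of_not_hasCluster (h : ¬ HasCluster r S) : Meets r W S :=
  fun C hC => (h ⟨C, hC⟩).elim

lemma not_allThrough_univ : ¬ AllThrough r v Set.univ S := fun h => h.1 meets_univ

lemma block_empty : Block r W' ∅ S := fun _ h => h.elim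

/-- A path cannot leave a cluster; conversely, the vertices that do not reach the root form a
cluster if there are any. -/
lemma rootConnected_iff : RootConnected r S ↔ ¬ HasCluster r S := by
  constructor
  · rintro h ⟨C, ⟨x, hx⟩, hr, hC⟩
    have key : ∀ y, Reaches S x y → y ∈ C := by
      intro y hy
      induction hy with
      | refl => exact hx
      | tail _ h ih =>
        obtain ⟨a, ha, rfl, rfl⟩ := h
        exact hC a ha ih
    exact hr (key r (h x))
  · intro h
    by_contra h'
    unfold RootConnected at h'
    push Not at h'
    obtain ⟨x, hx⟩ := h'
    refine h ⟨{y | ¬ Reaches S y r}, ⟨x, hx⟩, fun hr => hr Relation.ReflTransGen.refl,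
      fun a ha hs ht => hs ?_⟩
    exact Relation.ReflTransGen.head ⟨a, ha, rfl, rfl⟩ ht

lemma IsCluster.congr (h : ∀ a, a.src ∈ C → (a ∈ S ↔ a ∈ T)) :
    IsCluster r S C ↔ IsCluster r T C :=
  and_congr_right fun _ => and_congr_right fun _ =>
    ⟨fun hS a ha hs => hS a ((h a hs).2 ha) hs, fun hS a ha hs => hS a ((h a hs).1 ha) hs⟩

lemma IsMinimalCluster.congr (h : ∀ a, a.src ∈ C → (a ∈ S ↔ a ∈ T)) :
    IsMinimalCluster r S C ↔ IsMinimalCluster r T C :=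
  and_congr (IsCluster.congr h) (forall_congr' fun _ => imp_congr_right fun hD =>
    not_congr (IsCluster.congr fun a ha => h a (hD.1 ha)))

lemma localOn_block : LocalOn (outArcs G W) (Block r W' W) := fun S T h => by
  have key : ∀ C ⊆ W, (IsMinimalCluster r S C ↔ IsMinimalCluster r T C) := fun C hC =>
    IsMinimalCluster.congr fun a ha => h a (hC ha)
  constructor
  · intro hS x hx
    obtain ⟨C, h1, h2, h3, h4⟩ := hS x hx
    exact ⟨C, (key C h3).1 h1, h2, h3, h4⟩
  · intro hS x hx
    obtain ⟨C, h1, h2, h3, h4⟩ := hS x hx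
    exact ⟨C, (key C h3).2 h1, h2, h3, h4⟩

lemma IsCluster.congr_of_disjoint (h : ∀ a ∈ (outArcs G W)ᶜ, a ∈ S ↔ a ∈ T)
    (hC : Disjoint C W) : IsCluster r S C ↔ IsCluster r T C :=
  IsCluster.congr fun a ha => h a (Set.disjoint_left.1 hC ha)

lemma localOn_meets : LocalOn (outArcs G W)ᶜ (Meets r W) := by
  have key : ∀ S T : Finset (Arc G), (∀ a ∈ (outArcs G W)ᶜ, a ∈ S ↔ a ∈ T) → Meets r W S →
      Meets r W T := by
    intro S T h hS C hC
    by_contra hCW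
    rw [← Set.not_disjoint_iff_nonempty_inter, not_not] at hCW
    exact Set.not_disjoint_iff_nonempty_inter.2
      (hS C ((IsCluster.congr_of_disjoint h hCW).2 hC)) hCW
  exact fun S T h => ⟨key S T h, key T S fun a ha => (h a ha).symm⟩

lemma localOn_allThrough : LocalOn (outArcs G W)ᶜ (AllThrough r v W) := fun S T h =>
  and_congr (not_congr (localOn_meets S T h)) (forall_congr' fun _ =>
    ⟨fun hS hC hd => hS ((IsCluster.congr_of_disjoint h hd).2 hC) hd,
     fun hS hC hd => hS ((IsCluster.congr_of_disjoint h hd).1 hC) hd⟩)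

/-- The right side separates the variables: `Block r W' W` is local to the arcs out of `W` and
`Meets r W` to the remaining ones. This is what keeps the unpopped part of the state free of any
other conditioning. -/
lemma popped_eq_iff :
    popped r S = W ∧ Meets r W' S ↔ Block r W' W S ∧ Meets r W S := by
  constructor
  · rintro ⟨rfl, hW'⟩
    refine ⟨?_, fun C hC => ?_⟩
    · rintro x ⟨C, hC, hx⟩
      exact ⟨C, hC, hx, fun y hy => ⟨C, hC, hy⟩, hW' C hC.1⟩
    · obtain ⟨D, hDC, hD⟩ := hC.exists_minimal_subset
      obtain ⟨x, hx⟩ := hD.1.1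
      exact ⟨x, hDC hx, D, hD, hx⟩
  · rintro ⟨hB, hM⟩
    have key : ∀ C, IsMinimalCluster r S C → C ⊆ W ∧ (C ∩ W').Nonempty := by
      intro C hC
      obtain ⟨y, hyC, hyW⟩ := hM C hC.1
      obtain ⟨D, hD, hyD, hDW, hDW'⟩ := hB y hyW
      obtain rfl := hC.eq hD ⟨y, hyC, hyD⟩
      exact ⟨hDW, hDW'⟩
    refine ⟨Set.Subset.antisymm ?_ ?_, fun C hC => ?_⟩
    · rintro x ⟨C, hC, hx⟩
      exact (key C hC).1 hx
    · intro x hx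
      obtain ⟨C, hC, hxC, -⟩ := hB x hx
      exact ⟨C, hC, hxC⟩
    · obtain ⟨D, hDC, hD⟩ := hC.exists_minimal_subset
      exact (key D hD).2.mono (Set.inter_subset_inter_left _ hDC)

/-- A minimal cluster through `v`, all other minimal clusters intersecting `W'`. -/
def OthersMeet (r v : V) (W' : Set V) (S : Finset (Arc G)) : Prop :=
  v ∈ popped r S ∧ ∀ C, IsMinimalCluster r S C → v ∉ C → (C ∩ W').Nonempty

/-- The two alternatives are whether the minimal cluster through `v` is disjoint from `W'` or meets
it. -/
lemma othersMeet_iff :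
    OthersMeet r v W' S ↔ AllThrough r v W' S ∨ (v ∈ popped r S ∧ Meets r W' S) := by
  constructor
  · rintro ⟨hv, h⟩
    by_cases hM : Meets r W' S
    · exact Or.inr ⟨hv, hM⟩
    · refine Or.inl ⟨hM, fun C hC hd => ?_⟩
      obtain ⟨D, hDC, hD⟩ := hC.exists_minimal_subset
      by_contra hvC
      exact Set.not_disjoint_iff_nonempty_inter.2 (h D hD fun h => hvC (hDC h))
        (hd.mono_left hDC)
  · rintro (⟨hM, h⟩ | ⟨hv, h⟩)
    · constructor
      · unfold Meets at hM
        push Not at hM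
        obtain ⟨C, hC, hCW⟩ := hM
        obtain ⟨D, hDC, hD⟩ := hC.exists_minimal_subset
        exact ⟨D, hD, h D hD.1 ((Set.disjoint_iff_inter_eq_empty.2 hCW).mono_left hDC)⟩
      · intro C hC hv
        by_contra hne
        rw [← Set.not_disjoint_iff_nonempty_inter, not_not] at hne
        exact hv (h C hC.1 hne)
    · exact ⟨hv, fun C hC _ => h C hC.1⟩

/-- `W` must be the union of exactly the minimal clusters avoiding `v`: each of these meets `W`,
hence is one of its blocks, while some minimal cluster through `v` is disjoint from `W`. So a sum
over `W` has at most one non-zero term. -/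
lemma block_allThrough_eq (hB : Block r W' W S) (hA : AllThrough r v W S) :
    W = {x | ∃ C, IsMinimalCluster r S C ∧ v ∉ C ∧ x ∈ C} ∧ OthersMeet r v W' S := by
  have hother : ∀ C, IsMinimalCluster r S C → v ∉ C → C ⊆ W ∧ (C ∩ W').Nonempty := by
    intro C hC hv
    have hne : (C ∩ W).Nonempty := by
      rw [← Set.not_disjoint_iff_nonempty_inter]
      exact fun hd => hv (hA.2 C hC.1 hd)
    obtain ⟨y, hyC, hyW⟩ := hne
    obtain ⟨D, hD, hyD, hDW, hDW'⟩ := hB y hyW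
    obtain rfl := hC.eq hD ⟨y, hyC, hyD⟩
    exact ⟨hDW, hDW'⟩
  obtain ⟨C₀, hC₀, hvC₀, hdis⟩ : ∃ C, IsMinimalCluster r S C ∧ v ∈ C ∧ Disjoint C W := by
    have hM := hA.1
    unfold Meets at hM
    push Not at hM
    obtain ⟨C, hC, hCW⟩ := hM
    obtain ⟨D, hDC, hD⟩ := hC.exists_minimal_subset
    have hd : Disjoint D W := (Set.disjoint_iff_inter_eq_empty.2 hCW).mono_left hDC
    exact ⟨D, hD, hA.2 D hD.1 hd, hd⟩
  refine ⟨Set.Subset.antisymm ?_ ?_, ⟨C₀, hC₀, hvC₀⟩, fun C hC hv => (hother C hC hv).2⟩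
  · intro x hx
    obtain ⟨C, hC, hxC, hCW, -⟩ := hB x hx
    exact ⟨C, hC, fun hv => Set.disjoint_left.1 hdis hvC₀ (hCW hv), hxC⟩
  · rintro x ⟨C, hC, hv, hx⟩
    exact (hother C hC hv).1 hx

lemma OthersMeet.block_allThrough (h : OthersMeet r v W' S) :
    Block r W' {x | ∃ C, IsMinimalCluster r S C ∧ v ∉ C ∧ x ∈ C} S ∧
      AllThrough r v {x | ∃ C, IsMinimalCluster r S C ∧ v ∉ C ∧ x ∈ C} S := by
  obtain ⟨⟨C₀, hC₀, hv₀⟩, h⟩ := h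
  refine ⟨?_, fun hM => ?_, fun C hC hd => ?_⟩
  · rintro x ⟨C, hC, hv, hx⟩
    exact ⟨C, hC, hx, fun y hy => ⟨C, hC, hv, hy⟩, h C hC hv⟩
  · obtain ⟨y, hy, C, hC, hv, hyC⟩ := hM C₀ hC₀.1
    exact hv (hC₀.eq hC ⟨y, hy, hyC⟩ ▸ hv₀)
  · by_contra hv
    obtain ⟨D, hDC, hD⟩ := hC.exists_minimal_subset
    obtain ⟨x, hx⟩ := hD.1.1
    exact Set.disjoint_left.1 hd (hDC hx) ⟨D, hD, fun h => hv (hDC h), hx⟩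

lemma sum_ind_block_allThrough (r v : V) (W' : Set V) (S : Finset (Arc G)) :
    ∑ W, ind (Block r W' W S ∧ AllThrough r v W S)
      = ind (AllThrough r v W' S) + ind (v ∈ popped r S ∧ Meets r W' S) := by
  have hR : ind (AllThrough r v W' S) + ind (v ∈ popped r S ∧ Meets r W' S)
      = ind (OthersMeet r v W' S) := by
    rw [ind_congr othersMeet_iff]
    by_cases h1 : AllThrough r v W' S
    · have h2 : ¬ (v ∈ popped r S ∧ Meets r W' S) := fun h => h1.1 h.2
      simp [ind, h1, h2]
    · rw [ind_of_false h1, zero_add]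
      exact ind_congr (by simp [h1])
  rw [hR, Finset.sum_eq_single {x | ∃ C, IsMinimalCluster r S C ∧ v ∉ C ∧ x ∈ C}]
  · exact ind_congr ⟨fun h => (block_allThrough_eq h.1 h.2).2, fun h => h.block_allThrough⟩
  · intro W _ hne
    exact ind_of_false fun h => hne (block_allThrough_eq h.1 h.2).1
  · intro h
    exact (h (Finset.mem_univ _)).elim

lemma sum_ind_block_meets (r : V) (W' : Set V) (S : Finset (Arc G)) (P : Set V → Prop) :
    ∑ W, ind ((Block r W' W S ∧ Meets r W S) ∧ P W) = ind (Meets r W' S ∧ P (popped r S)) := by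
  rw [Finset.sum_eq_single (popped r S)]
  · refine ind_congr ?_
    rw [← popped_eq_iff]
    simp
  · intro W _ hne
    refine ind_of_false ?_
    rw [← popped_eq_iff]
    exact fun h => hne h.1.1.symm
  · intro h
    exact (h (Finset.mem_univ _)).elim

variable {p : Arc G → ℝ}

/-- The event `AllThrough r v W` plays the part of a potential: its change over one round accounts
for the probability that `v` is popped. -/
lemma prob_block_mul_allThrough (p : Arc G → ℝ) (r v : V) (W' : Set V) :
    ∑ W, prob p (Block r W' W) * prob p (AllThrough r v W)
      = prob p (AllThrough r v W') + prob p (fun S => v ∈ popped r S ∧ Meets r W' S) := by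
  simp_rw [← prob_and localOn_block localOn_allThrough, prob]
  rw [Finset.sum_comm, ← Finset.sum_add_distrib]
  refine Finset.sum_congr rfl fun S _ => ?_
  rw [← Finset.mul_sum, ← mul_add, sum_ind_block_allThrough]

lemma prob_block_mul_meets (p : Arc G → ℝ) (r : V) (W' : Set V) :
    ∑ W, prob p (Block r W' W) * prob p (Meets r W) = prob p (Meets r W') := by
  simp_rw [← prob_and localOn_block localOn_meets, prob]
  rw [Finset.sum_comm]
  refine Finset.sum_congr rfl fun S _ => ?_
  rw [← Finset.mul_sum]
  have := sum_ind_block_meets r W' S fun _ => True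
  simp only [and_true] at this
  rw [this]

/-- One round of cluster-popping, started from the weights restricted to `Meets r W'`. -/
lemma sum_resample (p : Arc G → ℝ) (r : V) (W' : Set V) (S' : Finset (Arc G)) :
    ∑ S, ∑ T, wt p S * wt p T * ind (Meets r W' S ∧ HasCluster r S ∧
        merge (outArcs G (popped r S)) T S = S')
      = ∑ W, ind (W ≠ ∅) * (prob p (Block r W' W) * (wt p S' * ind (Meets r W S'))) := by
  have h1 : ∀ S T, ind (Meets r W' S ∧ HasCluster r S ∧
        merge (outArcs G (popped r S)) T S = S')
      = ∑ W, ind (W ≠ ∅) * (ind (Block r W' W S) *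
          ind (Meets r W S ∧ merge (outArcs G W) T S = S')) := by
    intro S T
    rw [ind_congr (and_congr_right fun _ => and_congr_left fun _ => hasCluster_iff),
      ← sum_ind_block_meets r W' S fun W => W ≠ ∅ ∧ merge (outArcs G W) T S = S']
    refine Finset.sum_congr rfl fun W _ => ?_
    simp only [ind_and]
    ring
  have h2 : ∀ W, ∑ S, ∑ T, wt p S * wt p T * (ind (Block r W' W S) *
          ind (Meets r W S ∧ merge (outArcs G W) T S = S'))
      = prob p (Block r W' W) * (wt p S' * ind (Meets r W S')) := by
    intro W
    -- The swap over the arcs out of `W` turns the old state and the fresh draw into the discarded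
    -- arcs, which carry `Block`, and the new state, which carries `Meets`.
    have := sum_swap (p := p) (outArcs G W) fun S T =>
      ind (Block r W' W S) * ind (Meets r W T ∧ T = S')
    simp only [localOn_block.merge_left, localOn_meets.merge_right] at this
    rw [this]
    have h3 : wt p S' * ind (Meets r W S') = ∑ T, wt p T * ind (Meets r W T ∧ T = S') := by
      rw [Finset.sum_eq_single S']
      · simp
      · intro T _ hne
        rw [ind_of_false fun h => hne h.2, mul_zero]
      · simp
    rw [h3, prob, Finset.sum_mul_sum]
    refine Finset.sum_congr rfl fun S _ => Finset.sum_congr rfl fun T _ => ?_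
    ring
  simp_rw [h1, ← h2, Finset.mul_sum]
  rw [Finset.sum_comm' (t' := Finset.univ) (s' := fun _ => Finset.univ) (by simp)]
  conv_lhs => enter [2, T]; rw [Finset.sum_comm]
  rw [Finset.sum_comm]
  refine Finset.sum_congr rfl fun W _ => ?_
  rw [Finset.sum_comm]
  refine Finset.sum_congr rfl fun S _ => Finset.sum_congr rfl fun T _ => ?_
  ring

end Clusters

/-! ### The law of the running loop and the telescoping sums over histories. -/

section Chain

variable {V : Type*} [Fintype V] {G : Digraph V} {r v : V} {p : Arc G → ℝ}

/-- The total weight of the resampling histories of `t` rounds that end with popping `W`; the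
history of length zero counts as popping everything. -/
def layer (p : Arc G → ℝ) (r : V) : ℕ → Set V → ℝ
  | 0, W => ind (Set.univ = W)
  | t + 1, W => ind (W ≠ ∅) * ∑ W', layer p r t W' * prob p (Block r W' W)

/-- The probability that the loop is entered at least `t` times and then holds `S`. -/
def occupation (p : Arc G → ℝ) (r : V) (t : ℕ) (S : Finset (Arc G)) : ℝ :=
  wt p S * ∑ W, layer p r t W * ind (Meets r W S)

lemma layer_nonneg (hp : UnitRange p) (t : ℕ) (W : Set V) : 0 ≤ layer p r t W := by
  induction t generalizing W with
  | zero => exact ind_nonneg _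
  | succ t ih =>
    exact mul_nonneg (ind_nonneg _) (Finset.sum_nonneg fun W' _ =>
      mul_nonneg (ih W') (prob_nonneg hp _))

lemma occupation_nonneg (hp : UnitRange p) (t : ℕ) (S : Finset (Arc G)) :
    0 ≤ occupation p r t S :=
  mul_nonneg (wt_nonneg hp S) (Finset.sum_nonneg fun W _ =>
    mul_nonneg (layer_nonneg hp t W) (ind_nonneg _))

lemma occupation_zero (S : Finset (Arc G)) : occupation p r 0 S = wt p S := by
  simp only [occupation, layer]
  rw [sum_ind_eq, ind_of_true meets_univ, mul_one]

/-- The product form of `occupation` is preserved by a round of popping, so it satisfies the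
recursion of the algorithm. -/
lemma occupation_succ (t : ℕ) (S' : Finset (Arc G)) :
    occupation p r (t + 1) S' = ∑ S, ∑ T, occupation p r t S * wt p T *
      ind (HasCluster r S ∧ merge (outArcs G (popped r S)) T S = S') := by
  have h := fun W' => sum_resample p r W' S'
  calc occupation p r (t + 1) S'
      = ∑ W', layer p r t W' * ∑ W, ind (W ≠ ∅) *
          (prob p (Block r W' W) * (wt p S' * ind (Meets r W S'))) := by
        simp only [occupation, layer, Finset.mul_sum, Finset.sum_mul]
        rw [Finset.sum_comm]
        refine Finset.sum_congr rfl fun W' _ => Finset.sum_congr rfl fun W _ => ?_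
        ring
    _ = _ := by
        simp_rw [← h, occupation, Finset.mul_sum, Finset.sum_mul]
        rw [Finset.sum_comm]
        refine Finset.sum_congr rfl fun S _ => ?_
        rw [Finset.sum_comm]
        refine Finset.sum_congr rfl fun T _ => Finset.sum_congr rfl fun W' _ => ?_
        rw [ind_and]
        ring

/-- The term `W = ∅` is split off: `Block r W' ∅` always holds, whereas `layer` admits only
non-empty popped sets. Applied to the two potentials `Meets` and `AllThrough`, this makes the sums
over rounds telescope. -/
lemma sum_layer_mul_block (t : ℕ) (f : Set V → ℝ) :
    ∑ W', layer p r t W' * ∑ W, prob p (Block r W' W) * f W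
      = (∑ W, layer p r t W) * f ∅ + ∑ W, layer p r (t + 1) W * f W := by
  have h0 : ∀ W', prob p (Block r W' ∅) = 1 := fun W' => by
    rw [← prob_true p]
    exact prob_congr fun S => by simp [block_empty]
  have h1 : ∀ W', ∑ W, prob p (Block r W' W) * f W
      = f ∅ + ∑ W, ind (W ≠ ∅) * (prob p (Block r W' W) * f W) := by
    intro W'
    have : ∀ W : Set V, prob p (Block r W' W) * f W = ind (∅ = W) * (prob p (Block r W' W) * f W)
        + ind (W ≠ ∅) * (prob p (Block r W' W) * f W) := by
      intro W
      by_cases hW : W = ∅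
      · subst hW
        simp [ind]
      · simp [ind, hW, Ne.symm hW]
    rw [Finset.sum_congr rfl fun W _ => this W, Finset.sum_add_distrib, sum_ind_eq, h0, one_mul]
  simp_rw [h1, mul_add, Finset.sum_add_distrib, ← Finset.sum_mul, layer, Finset.mul_sum,
    Finset.sum_mul]
  congr 1
  rw [Finset.sum_comm]
  refine Finset.sum_congr rfl fun W' _ => Finset.sum_congr rfl fun W _ => ?_
  ring

lemma sum_occupation_mul (t : ℕ) (E : Finset (Arc G) → Prop) :
    ∑ S, occupation p r t S * ind (E S)
      = ∑ W, layer p r t W * prob p (fun S => E S ∧ Meets r W S) := by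
  simp only [occupation, prob, Finset.mul_sum, Finset.sum_mul]
  rw [Finset.sum_comm]
  refine Finset.sum_congr rfl fun W' _ => Finset.sum_congr rfl fun W _ => ?_
  rw [ind_and]
  ring

lemma sum_occupation_eq (t : ℕ) :
    ∑ S, occupation p r t S = ∑ W, layer p r t W * prob p (Meets r W) := by
  simpa [ind] using sum_occupation_mul (p := p) (r := r) t fun _ => True

lemma sum_occupation_succ (t : ℕ) :
    ∑ S, occupation p r t S
      = (∑ W, layer p r t W) * prob p (Meets r ∅) + ∑ S, occupation p r (t + 1) S := by
  rw [sum_occupation_eq, sum_occupation_eq, ← sum_layer_mul_block t fun W => prob p (Meets r W)]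
  simp_rw [prob_block_mul_meets]

lemma sum_occupation_le (hp : UnitRange p) (t : ℕ) :
    ∑ S, occupation p r t S ≤ ∑ W, layer p r t W := by
  rw [sum_occupation_eq]
  exact Finset.sum_le_sum fun W _ =>
    mul_le_of_le_one_right (layer_nonneg hp t W) (prob_le_one hp _)

/-- The mass that has stopped before round `t` and the mass still running add up to one. -/
lemma sum_range_layer (t : ℕ) :
    (∑ s ∈ Finset.range t, ∑ W, layer p r s W) * prob p (Meets r ∅)
      + ∑ S, occupation p r t S = 1 := by
  induction t with
  | zero => simp [occupation_zero, sum_wt]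
  | succ t ih =>
    rw [Finset.sum_range_succ]
    linarith [sum_occupation_succ (p := p) (r := r) t]

lemma summable_layer (hp : UnitRange p) (hZ : 0 < prob p (Meets r ∅)) :
    Summable fun t => ∑ W, layer p r t W := by
  refine summable_of_sum_range_le (c := (prob p (Meets r ∅))⁻¹)
    (fun t => Finset.sum_nonneg fun W _ => layer_nonneg hp t W) fun t => ?_
  rw [← one_div, le_div_iff₀ hZ]
  have := sum_range_layer (p := p) (r := r) t
  have h2 : 0 ≤ ∑ S, occupation p r t S :=
    Finset.sum_nonneg fun S _ => occupation_nonneg hp t S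
  linarith

lemma tendsto_sum_occupation (hp : UnitRange p) (hZ : 0 < prob p (Meets r ∅)) :
    Tendsto (fun t => ∑ S, occupation p r t S) atTop (𝓝 0) :=
  squeeze_zero (fun t => Finset.sum_nonneg fun S _ => occupation_nonneg hp t S)
    (fun t => sum_occupation_le hp t) (summable_layer hp hZ).tendsto_atTop_zero

lemma hasSum_layer (hp : UnitRange p) (hZ : 0 < prob p (Meets r ∅)) :
    HasSum (fun t => ∑ W, layer p r t W) (prob p (Meets r ∅))⁻¹ := by
  rw [hasSum_iff_tendsto_nat_of_nonneg
    (fun t => Finset.sum_nonneg fun W _ => layer_nonneg hp t W)]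
  have h : ∀ t, ∑ s ∈ Finset.range t, ∑ W, layer p r s W
      = (1 - ∑ S, occupation p r t S) / prob p (Meets r ∅) := fun t => by
    rw [eq_div_iff hZ.ne']
    linarith [sum_range_layer (p := p) (r := r) t]
  simp_rw [h]
  simpa using ((tendsto_sum_occupation hp hZ).const_sub 1).div_const (prob p (Meets r ∅))

/-- The expected number of rounds that pop the vertex `v`. -/
lemma hasSum_occupation_popped (hp : UnitRange p) (hZ : 0 < prob p (Meets r ∅)) (v : V) :
    HasSum (fun t => ∑ S, occupation p r t S * ind (v ∈ popped r S))
      (prob p (AllThrough r v ∅) / prob p (Meets r ∅)) := by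
  set Y : ℕ → ℝ := fun t => ∑ W, layer p r t W * prob p (AllThrough r v W) with hY
  have hstep : ∀ t, Y t + ∑ S, occupation p r t S * ind (v ∈ popped r S)
      = (∑ W, layer p r t W) * prob p (AllThrough r v ∅) + Y (t + 1) := by
    intro t
    rw [hY, sum_occupation_mul]
    simp only
    rw [← sum_layer_mul_block t fun W => prob p (AllThrough r v W), ← Finset.sum_add_distrib]
    refine Finset.sum_congr rfl fun W _ => ?_
    rw [prob_block_mul_allThrough, mul_add]
  -- The empty history is assigned the popped set `Set.univ`, which every cluster meets.
  have hY0 : Y 0 = 0 := by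
    simp only [hY, layer]
    rw [sum_ind_eq]
    exact Finset.sum_eq_zero fun S _ => by rw [ind_of_false not_allThrough_univ, mul_zero]
  have hYt : Tendsto Y atTop (𝓝 0) :=
    squeeze_zero
      (fun t => Finset.sum_nonneg fun W _ => mul_nonneg (layer_nonneg hp t W) (prob_nonneg hp _))
      (fun t => Finset.sum_le_sum fun W _ =>
        mul_le_of_le_one_right (layer_nonneg hp t W) (prob_le_one hp _))
      (summable_layer hp hZ).tendsto_atTop_zero
  have hsum : ∀ t, ∑ s ∈ Finset.range t, ∑ S, occupation p r s S * ind (v ∈ popped r S)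
      = (∑ s ∈ Finset.range t, ∑ W, layer p r s W) * prob p (AllThrough r v ∅) + Y t := by
    intro t
    induction t with
    | zero => simp [hY0]
    | succ t ih =>
      rw [Finset.sum_range_succ, Finset.sum_range_succ, ih]
      linarith [hstep t]
  rw [hasSum_iff_tendsto_nat_of_nonneg fun t => Finset.sum_nonneg fun S _ =>
    mul_nonneg (occupation_nonneg hp t S) (ind_nonneg _)]
  simp_rw [hsum]
  have := ((hasSum_layer hp hZ).tendsto_sum_nat.mul_const (prob p (AllThrough r v ∅))).add hYt
  rwa [add_zero, inv_mul_eq_div] at this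

/-- The factor multiplying `wt p S` does not depend on `S`; this is why the output is distributed as
the target. -/
lemma occupation_of_not_hasCluster {S : Finset (Arc G)} (hS : ¬ HasCluster r S) (t : ℕ) :
    occupation p r t S = wt p S * ∑ W, layer p r t W := by
  simp [occupation, ind_of_true (meets_of_not_hasCluster hS)]

lemma hasSum_occupation (hp : UnitRange p) (hZ : 0 < prob p (Meets r ∅))
    {S : Finset (Arc G)} (hS : ¬ HasCluster r S) :
    HasSum (fun t => occupation p r t S) (wt p S / prob p (Meets r ∅)) := by
  simp_rw [occupation_of_not_hasCluster hS, div_eq_mul_inv]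
  exact (hasSum_layer hp hZ).mul_left _

end Chain

/-! ### Transfer from the finite weights to the probability space of all draws. -/

section Run

variable {V : Type*} [Fintype V] {G : Digraph V} {r v : V} {p : Arc G → ℝ}

/-- The subgraph encoded by one draw of all arcs. -/
def sample (x : Arc G → Bool) : Finset (Arc G) := Finset.univ.filter fun a => x a = true

lemma mem_sample {x : Arc G → Bool} {a : Arc G} : a ∈ sample x ↔ x a = true := by
  simp [sample]

lemma state_zero (ω : ℕ → Arc G → Bool) : state r ω 0 = sample (ω 0) := by
  ext a
  rw [mem_sample, state]
  simp

lemma state_succ (ω : ℕ → Arc G → Bool) (t : ℕ) :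
    state r ω (t + 1)
      = merge (outArcs G (popped r (state r ω t))) (sample (ω (t + 1))) (state r ω t) := by
  ext a
  rw [mem_merge, mem_sample, state]
  have h : a ∈ outArcs G (popped r (state r ω t)) ↔ a ∈ resampled r (state r ω t) :=
    mem_resampled.symm
  rw [h]
  by_cases h' : a ∈ resampled r (state r ω t) <;> simp [h']

lemma state_congr {ω ω' : ℕ → Arc G → Bool} {t : ℕ} (h : ∀ s ≤ t, ω s = ω' s) :
    state r ω t = state r ω' t := by
  induction t with
  | zero => rw [state_zero, state_zero, h 0 le_rfl]
  | succ t ih =>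
    rw [state_succ, state_succ, ih fun s hs => h s (by omega), h (t + 1) le_rfl]

lemma state_succ_of_not_hasCluster {ω : ℕ → Arc G → Bool} {t : ℕ}
    (h : ¬ HasCluster r (state r ω t)) : state r ω (t + 1) = state r ω t := by
  rw [hasCluster_iff, not_not] at h
  rw [state_succ, h]
  ext a
  simp [mem_merge, outArcs]

lemma hasCluster_of_le {ω : ℕ → Arc G → Bool} {s t : ℕ} (hst : s ≤ t)
    (h : HasCluster r (state r ω t)) : HasCluster r (state r ω s) := by
  induction t, hst using Nat.le_induction with
  | base => exact h
  | succ t _ ih =>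
    refine ih ?_
    by_contra h'
    rw [state_succ_of_not_hasCluster h'] at h
    exact h' h

/-- The loop is entered at least `t` times and then holds `S`. -/
def runEvent (r : V) (t : ℕ) (S : Finset (Arc G)) : Set (ℕ → Arc G → Bool) :=
  {ω | (∀ s < t, HasCluster r (state r ω s)) ∧ state r ω t = S}

lemma runEvent_succ (t : ℕ) (S' : Finset (Arc G)) :
    runEvent r (t + 1) S' = ⋃ x ∈ (Set.toFinite {x : Finset (Arc G) × Finset (Arc G) |
        HasCluster r x.1 ∧ merge (outArcs G (popped r x.1)) x.2 x.1 = S'}).toFinset,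
      runEvent r t x.1 ∩ {ω | sample (ω (t + 1)) = x.2} := by
  ext ω
  simp only [runEvent, Set.mem_ofPred_eq, Set.Finite.mem_toFinset, Set.mem_iUnion, Set.mem_inter_iff,
    exists_prop, Prod.exists]
  constructor
  · rintro ⟨h1, h2⟩
    exact ⟨state r ω t, sample (ω (t + 1)), ⟨h1 t (by omega), by rw [← state_succ, h2]⟩,
      ⟨fun s hs => h1 s (by omega), rfl⟩, rfl⟩
  · rintro ⟨S, T, ⟨hS, hST⟩, ⟨h1, rfl⟩, rfl⟩
    refine ⟨fun s hs => ?_, by rw [state_succ, hST]⟩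
    exact hasCluster_of_le (Nat.lt_succ_iff.1 hs) hS

lemma arcLaw_singleton {q : ℝ} (b : Bool) :
    arcLaw q {b} = ENNReal.ofReal (if b = true then 1 - q else q) := by
  cases b <;> simp [arcLaw]

lemma isProbabilityMeasure_arcLaw {q : ℝ} (h : 0 ≤ q ∧ q ≤ 1) :
    IsProbabilityMeasure (arcLaw q) := by
  constructor
  simp only [arcLaw, Measure.add_apply, Measure.smul_apply, measure_univ, smul_eq_mul, mul_one]
  rw [← ENNReal.ofReal_add (by linarith) h.1]
  simp

lemma pi_arcLaw_sample (hp : UnitRange p) (S : Finset (Arc G)) :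
    Measure.pi (fun a => arcLaw (p a)) {x | sample x = S} = ENNReal.ofReal (wt p S) := by
  classical
  have : ∀ a, IsProbabilityMeasure (arcLaw (p a)) := fun a => isProbabilityMeasure_arcLaw (hp a)
  have h : {x : Arc G → Bool | sample x = S} = {fun a => decide (a ∈ S)} := by
    ext x
    simp only [Set.mem_ofPred_eq, Set.mem_singleton_iff, Finset.ext_iff, mem_sample, funext_iff]
    refine forall_congr' fun a => ?_
    by_cases ha : a ∈ S <;> simp [ha]
  rw [h, Measure.pi_singleton, wt_eq, ENNReal.ofReal_prod_of_nonneg]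
  · refine Finset.prod_congr rfl fun a _ => ?_
    rw [arcLaw_singleton]
    by_cases ha : a ∈ S <;> simp [ha, ind]
  · intro a _
    exact add_nonneg (mul_nonneg (ind_nonneg _) (by linarith [(hp a).2]))
      (mul_nonneg (ind_nonneg _) (hp a).1)

lemma isProbabilityMeasure_pi (hp : UnitRange p) :
    IsProbabilityMeasure (Measure.pi fun a => arcLaw (p a)) := by
  have : ∀ a, IsProbabilityMeasure (arcLaw (p a)) := fun a => isProbabilityMeasure_arcLaw (hp a)
  infer_instance

lemma isProbabilityMeasure_drawMeasure (hp : UnitRange p) :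
    IsProbabilityMeasure (drawMeasure p) := by
  have := isProbabilityMeasure_pi hp
  unfold drawMeasure
  infer_instance

lemma drawMeasure_sample (hp : UnitRange p) (t : ℕ) (S : Finset (Arc G)) :
    drawMeasure p {ω | sample (ω t) = S} = ENNReal.ofReal (wt p S) := by
  have := isProbabilityMeasure_pi hp
  have h := Measure.infinitePi_map_eval (fun _ : ℕ => Measure.pi fun a => arcLaw (p a)) t
  rw [← pi_arcLaw_sample hp S, drawMeasure]
  conv_rhs => rw [← h]
  rw [Measure.map_apply (measurable_pi_apply t) (Set.toFinite _).measurableSet]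
  rfl

/-- The draws of the rounds up to `t`, extended by a constant. -/
def extendDraws (t : ℕ) (x : Finset.range (t + 1) → Arc G → Bool) : ℕ → Arc G → Bool :=
  fun s => if h : s ∈ Finset.range (t + 1) then x ⟨s, h⟩ else fun _ => false

/-- Only the draws of rounds `0, …, t` matter, and these take finitely many values. Measurability
and independence from round `t + 1` both follow. -/
lemma runEvent_eq_preimage (t : ℕ) (S : Finset (Arc G)) :
    runEvent r t S = (fun (ω : ℕ → Arc G → Bool) (i : Finset.range (t + 1)) => ω i) ⁻¹'
      {x | extendDraws t x ∈ runEvent r t S} := by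
  ext ω
  have h : ∀ s ≤ t, state r (extendDraws t fun i => ω i) s = state r ω s := by
    intro s hs
    refine state_congr fun s' hs' => ?_
    have : s' < t + 1 := by omega
    simp [extendDraws, this]
  simp only [runEvent, Set.mem_preimage, Set.mem_ofPred_eq]
  rw [h t le_rfl]
  refine and_congr_left fun _ => forall_congr' fun s => imp_congr_right fun hs => ?_
  rw [h s hs.le]

lemma measurableSet_runEvent (t : ℕ) (S : Finset (Arc G)) : MeasurableSet (runEvent r t S) := by
  rw [runEvent_eq_preimage]
  exact (measurable_pi_lambda _ fun i => measurable_pi_apply _) (Set.toFinite _).measurableSet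

lemma measurableSet_sample (t : ℕ) (S : Finset (Arc G)) :
    MeasurableSet {ω : ℕ → Arc G → Bool | sample (ω t) = S} :=
  (measurable_pi_apply (X := fun _ : ℕ => Arc G → Bool) t)
    (Set.toFinite {x : Arc G → Bool | sample x = S}).measurableSet

lemma drawMeasure_runEvent_inter (hp : UnitRange p) (t : ℕ) (S T : Finset (Arc G)) :
    drawMeasure p (runEvent r t S ∩ {ω | sample (ω (t + 1)) = T})
      = drawMeasure p (runEvent r t S) * ENNReal.ofReal (wt p T) := by
  have := isProbabilityMeasure_pi hp
  rw [← drawMeasure_sample hp (t + 1) T]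
  have hind := ProbabilityTheory.iIndepFun_infinitePi
    (P := fun _ : ℕ => Measure.pi fun a => arcLaw (p a)) (X := fun _ x => x)
    (fun _ => measurable_id)
  have h2 := hind.indepFun_finset (Finset.range (t + 1)) {t + 1} (by simp)
    fun i => measurable_pi_apply i
  have h3 : {ω : ℕ → Arc G → Bool | sample (ω (t + 1)) = T}
      = (fun (ω : ℕ → Arc G → Bool) (i : ({t + 1} : Finset ℕ)) => ω i) ⁻¹'
        {x | sample (x ⟨t + 1, by simp⟩) = T} := rfl
  rw [runEvent_eq_preimage, h3]
  exact h2.measure_inter_preimage_eq_mul _ _ (Set.toFinite _).measurableSet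
    (Set.toFinite _).measurableSet

/-- The measure of the run event and `occupation` obey the same recursion, since the fresh draw is
independent of the past. -/
lemma drawMeasure_runEvent (hp : UnitRange p) (t : ℕ) (S : Finset (Arc G)) :
    drawMeasure p (runEvent r t S) = ENNReal.ofReal (occupation p r t S) := by
  classical
  induction t generalizing S with
  | zero =>
    rw [occupation_zero, ← drawMeasure_sample hp 0 S]
    congr 1
    ext ω
    simp [runEvent, state_zero]
  | succ t ih =>
    rw [runEvent_succ, measure_biUnion_finset, occupation_succ]
    · simp_rw [drawMeasure_runEvent_inter hp, ih]
      rw [← Finset.sum_product', Finset.univ_product_univ, ENNReal.ofReal_sum_of_nonneg]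
      · rw [← Finset.sum_filter_of_ne (s := Finset.univ) (p := fun x : Finset (Arc G) × Finset (Arc G) =>
          HasCluster r x.1 ∧ merge (outArcs G (popped r x.1)) x.2 x.1 = S)]
        · refine Finset.sum_congr ?_ fun x hx => ?_
          · ext x
            simp
          · rw [Finset.mem_filter] at hx
            rw [ind_of_true hx.2, mul_one, ENNReal.ofReal_mul (occupation_nonneg hp t _)]
        · intro x _ hx
          by_contra hne
          exact hx (by rw [ind_of_false hne]; simp)
      · intro x _
        exact mul_nonneg (mul_nonneg (occupation_nonneg hp t _) (wt_nonneg hp _)) (ind_nonneg _)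
    · intro x _ y _ hxy
      refine Set.disjoint_left.2 fun ω hx hy => hxy ?_
      exact Prod.ext (hx.1.2.symm.trans hy.1.2) (hx.2.symm.trans hy.2)
    · intro x _
      exact (measurableSet_runEvent t _).inter (measurableSet_sample _ _)

lemma measurableSet_returns (S : Finset (Arc G)) :
    MeasurableSet {ω : ℕ → Arc G → Bool | Returns r ω S} := by
  by_cases hS : HasCluster r S
  · convert MeasurableSet.empty
    ext ω
    simp only [Returns, Set.mem_ofPred_eq, Set.mem_empty_iff_false, iff_false]
    rintro ⟨t, -, h, rfl⟩
    exact h hS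
  · have : {ω : ℕ → Arc G → Bool | Returns r ω S} = ⋃ t, runEvent r t S := by
      ext ω
      simp only [Returns, runEvent, Set.mem_ofPred_eq, Set.mem_iUnion]
      exact exists_congr fun t => and_congr_right fun _ =>
        ⟨fun h => h.2, fun h => ⟨h ▸ hS, h⟩⟩
    rw [this]
    exact MeasurableSet.iUnion fun t => measurableSet_runEvent t S

lemma drawMeasure_returns (hp : UnitRange p) (hZ : 0 < prob p (Meets r ∅)) (S : Finset (Arc G)) :
    drawMeasure p {ω | Returns r ω S}
      = ENNReal.ofReal (ind (RootConnected r S) * (wt p S / prob p (Meets r ∅))) := by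
  rw [ind_congr rootConnected_iff]
  by_cases hS : HasCluster r S
  · rw [ind_of_false (not_not.2 hS), zero_mul, ENNReal.ofReal_zero]
    convert measure_empty (μ := drawMeasure p)
    ext ω
    simp only [Returns, Set.mem_ofPred_eq, Set.mem_empty_iff_false, iff_false]
    rintro ⟨t, -, h, rfl⟩
    exact h hS
  · have : {ω : ℕ → Arc G → Bool | Returns r ω S} = ⋃ t, runEvent r t S := by
      ext ω
      simp only [Returns, runEvent, Set.mem_ofPred_eq, Set.mem_iUnion]
      exact exists_congr fun t => and_congr_right fun _ =>
        ⟨fun h => h.2, fun h => ⟨h ▸ hS, h⟩⟩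
    rw [this, measure_iUnion, ind_of_true hS, one_mul, ← (hasSum_occupation hp hZ hS).tsum_eq,
      ENNReal.ofReal_tsum_of_nonneg (fun t => occupation_nonneg hp t S)
        (hasSum_occupation hp hZ hS).summable]
    · exact tsum_congr fun t => drawMeasure_runEvent hp t S
    · have key : ∀ s t, s < t → Disjoint (runEvent r s S) (runEvent r t S) := by
        intro s t hst
        refine Set.disjoint_left.2 fun ω h1 h2 => hS ?_
        rw [← h1.2]
        exact h2.1 s hst
      intro s t hst
      rcases lt_or_gt_of_ne hst with h | h
      · exact key s t h
      · exact (key t s h).symm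
    · exact fun t => measurableSet_runEvent t S

lemma Returns.unique {ω : ℕ → Arc G → Bool} {S T : Finset (Arc G)} (hS : Returns r ω S)
    (hT : Returns r ω T) : S = T := by
  obtain ⟨s, h1, h2, rfl⟩ := hS
  obtain ⟨t, h3, h4, rfl⟩ := hT
  have : s = t := by
    by_contra hne
    rcases lt_or_gt_of_ne hne with h | h
    · exact h2 (h3 s h)
    · exact h4 (h1 t h)
  rw [this]

lemma target_eq (S : Finset (Arc G)) :
    target r p S = ind (RootConnected r S) * (wt p S / prob p (Meets r ∅)) := by
  classical
  have : ∑ S' ∈ Finset.univ.filter (fun S' : Finset (Arc G) => RootConnected r S'), wt p S'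
      = prob p (Meets r ∅) := by
    rw [prob, Finset.sum_filter]
    refine Finset.sum_congr rfl fun S' _ => ?_
    rw [ind_congr (meets_empty.trans rootConnected_iff.symm)]
    by_cases h : RootConnected r S' <;> simp [ind, h]
  unfold target
  rw [← this]
  by_cases h : RootConnected r S
  · rw [if_pos h, ind_of_true h, one_mul]
  · rw [if_neg h, ind_of_false h, zero_mul]

lemma ae_returns (hp : UnitRange p) (hZ : 0 < prob p (Meets r ∅)) :
    ∀ᵐ ω ∂(drawMeasure p), ∃ S, Returns r ω S := by
  classical
  have := isProbabilityMeasure_drawMeasure hp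
  have hU : {ω : ℕ → Arc G → Bool | ∃ S, Returns r ω S}
      = ⋃ S ∈ (Finset.univ : Finset (Finset (Arc G))), {ω | Returns r ω S} := by
    ext ω; simp
  have hm : MeasurableSet {ω : ℕ → Arc G → Bool | ∃ S, Returns r ω S} := by
    rw [hU]
    exact Finset.measurableSet_biUnion _ fun S _ => measurableSet_returns S
  refine (mem_ae_iff_prob_eq_one hm).2 ?_
  rw [hU, measure_biUnion_finset]
  · simp_rw [drawMeasure_returns hp hZ]
    rw [← ENNReal.ofReal_sum_of_nonneg]
    · have : ∑ S : Finset (Arc G), ind (RootConnected r S) * (wt p S / prob p (Meets r ∅)) = 1 := by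
        rw [← div_self hZ.ne']
        conv_rhs => enter [1]; rw [prob]
        rw [Finset.sum_div]
        refine Finset.sum_congr rfl fun S _ => ?_
        rw [ind_congr (meets_empty.trans rootConnected_iff.symm)]
        ring
      rw [this, ENNReal.ofReal_one]
    · exact fun S _ => mul_nonneg (ind_nonneg _) (div_nonneg (wt_nonneg hp S) hZ.le)
  · intro S _ T _ hST
    exact Set.disjoint_left.2 fun ω h1 h2 => hST (Returns.unique h1 h2)
  · exact fun S _ => measurableSet_returns S

lemma card_resampled (S : Finset (Arc G)) :
    ((resampled r S).card : ℝ) = ∑ a : Arc G, ind (a.src ∈ popped r S) := by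
  classical
  have : resampled r S = Finset.univ.filter fun a : Arc G => a.src ∈ popped r S := by
    ext a
    simp [mem_resampled]
  rw [this, Finset.card_filter]
  push_cast
  exact Finset.sum_congr rfl fun a _ => by
    by_cases h : a.src ∈ popped r S <;> simp [ind, h]

lemma lintegral_card_resampled (hp : UnitRange p) (t : ℕ) :
    ∫⁻ ω, ((resampled r (state r ω t)).card : ℝ≥0∞) ∂(drawMeasure p)
      = ENNReal.ofReal (∑ a : Arc G, ∑ S, occupation p r t S * ind (a.src ∈ popped r S)) := by
  classical
  have h1 : ∀ ω : ℕ → Arc G → Bool, ((resampled r (state r ω t)).card : ℝ≥0∞)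
      = ∑ S, (runEvent r t S).indicator (fun _ => ((resampled r S).card : ℝ≥0∞)) ω := by
    intro ω
    by_cases h : ∀ s < t, HasCluster r (state r ω s)
    · rw [Finset.sum_eq_single (state r ω t)]
      · rw [Set.indicator_of_mem]
        exact ⟨h, rfl⟩
      · intro S _ hne
        rw [Set.indicator_of_notMem]
        exact fun h' => hne h'.2.symm
      · simp
    · rw [Finset.sum_eq_zero fun S _ => Set.indicator_of_notMem (fun h' => h h'.1) _]
      -- Once the loop has ended, no later state has a cluster, so nothing is redrawn.
      have hn : ¬ HasCluster r (state r ω t) := fun h' => h fun s hs => hasCluster_of_le hs.le h'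
      rw [hasCluster_iff, not_not] at hn
      have : resampled r (state r ω t) = ∅ := by
        ext a
        simp [mem_resampled, hn]
      simp [this]
  simp_rw [h1]
  rw [lintegral_finsetSum _ fun S _ => measurable_const.indicator (measurableSet_runEvent t S)]
  simp_rw [lintegral_indicator_const (measurableSet_runEvent t _), drawMeasure_runEvent hp]
  rw [Finset.sum_comm, ENNReal.ofReal_sum_of_nonneg]
  · refine Finset.sum_congr rfl fun S _ => ?_
    rw [← Finset.mul_sum, ← card_resampled, mul_comm, ENNReal.ofReal_mul (occupation_nonneg hp t S),
      ENNReal.ofReal_natCast]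
  · exact fun S _ => Finset.sum_nonneg fun a _ =>
      mul_nonneg (occupation_nonneg hp t S) (ind_nonneg _)

/-- The exact expected number of draws. -/
lemma expectedDraws_eq (hp : UnitRange p) (hZ : 0 < prob p (Meets r ∅)) :
    expectedDraws r p = ENNReal.ofReal ((Nat.card (Arc G) : ℝ)
      + ∑ a : Arc G, prob p (AllThrough r a.src ∅) / prob p (Meets r ∅)) := by
  have := isProbabilityMeasure_drawMeasure hp
  have hs := hasSum_sum (s := (Finset.univ : Finset (Arc G)))
    fun a _ => hasSum_occupation_popped (r := r) hp hZ a.src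
  have hmeas : ∀ t, Measurable fun ω : ℕ → Arc G → Bool =>
      ((resampled r (state r ω t)).card : ℝ≥0∞) := by
    intro t
    have : (fun ω : ℕ → Arc G → Bool => ((resampled r (state r ω t)).card : ℝ≥0∞))
        = (fun x => ((resampled r (state r (extendDraws t x) t)).card : ℝ≥0∞)) ∘
          (fun (ω : ℕ → Arc G → Bool) (i : Finset.range (t + 1)) => ω i) := by
      funext ω
      have h : state r (extendDraws t fun i => ω i) t = state r ω t := by
        refine state_congr fun s hs => ?_
        have : s < t + 1 := by omega
        simp [extendDraws, this]
      simp only [Function.comp_apply, h]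
    rw [this]
    exact (measurable_of_finite _).comp (measurable_pi_lambda _ fun i => measurable_pi_apply _)
  unfold expectedDraws draws
  rw [lintegral_add_left measurable_const, lintegral_const, measure_univ, mul_one,
    lintegral_tsum fun t => (hmeas t).aemeasurable]
  simp_rw [lintegral_card_resampled hp]
  rw [← ENNReal.ofReal_tsum_of_nonneg _ hs.summable, hs.tsum_eq, ENNReal.ofReal_add,
    ENNReal.ofReal_natCast]
  · exact Nat.cast_nonneg _
  · exact Finset.sum_nonneg fun a _ => div_nonneg (prob_nonneg hp _) hZ.le
  · exact fun t => Finset.sum_nonneg fun a _ => Finset.sum_nonneg fun S _ =>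
      mul_nonneg (occupation_nonneg hp t S) (ind_nonneg _)

end Run

/-! ### The repair map and the bound by cut arcs. -/

section UpperBound

variable {V : Type*} [Fintype V] {G : Digraph V} {r v : V} {p : Arc G → ℝ}

lemma reaches_step {S : Finset (Arc G)} {a : Arc G} (ha : a ∈ S) {y : V}
    (h : Reaches S a.tgt y) : Reaches S a.src y :=
  Relation.ReflTransGen.head ⟨a, ha, rfl, rfl⟩ h

lemma Reaches.closed {S : Finset (Arc G)} {x y : V} (h : Reaches S x y) {W : Set V}
    (hW : ∀ a ∈ S, a.src ∈ W → a.tgt ∈ W) (hx : x ∈ W) : y ∈ W := by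
  induction h with
  | refl => exact hx
  | tail _ h ih =>
    obtain ⟨a, ha, rfl, rfl⟩ := h
    exact hW a ha ih

lemma Reaches.head_rec {S : Finset (Arc G)} {x y : V} (h : Reaches S x y) {P : V → Prop}
    (hy : P y) (hstep : ∀ a ∈ S, Reaches S a.tgt y → P a.tgt → P a.src) : P x := by
  induction h using Relation.ReflTransGen.head_induction_on with
  | refl => exact hy
  | head h h' ih =>
    obtain ⟨a, ha, rfl, rfl⟩ := h
    exact hstep a ha h' ih

lemma Reaches.of_subset {S T : Finset (Arc G)} {x y : V} (h : Reaches S x y) (hST : S ⊆ T) :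
    Reaches T x y :=
  h.head_rec (P := fun x => Reaches T x y) Relation.ReflTransGen.refl
    fun _ ha _ ih => reaches_step (hST ha) ih

/-- The anti-parallel twin of an arc. -/
def twin (hG : IsBidirected G) (a : Arc G) : Arc G := ⟨a.tgt, a.src, hG _ _ a.adj⟩

open Classical in
/-- The involution of the arcs that reverses those with both ends in `W`. -/
def flipArc (hG : IsBidirected G) (W : Set V) (a : Arc G) : Arc G :=
  if a.src ∈ W ∧ a.tgt ∈ W then twin hG a else a

lemma flipArc_flipArc (hG : IsBidirected G) (W : Set V) (a : Arc G) :
    flipArc hG W (flipArc hG W a) = a := by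
  unfold flipArc
  by_cases h : a.src ∈ W ∧ a.tgt ∈ W
  · simp [h, twin]
  · simp [h]

/-- The subgraph obtained from `S` by reversing all arcs with both ends in `W`. -/
def revWithin (hG : IsBidirected G) (W : Set V) (S : Finset (Arc G)) : Finset (Arc G) := by
  classical exact Finset.univ.filter fun a => flipArc hG W a ∈ S

lemma mem_revWithin {hG : IsBidirected G} {W : Set V} {S : Finset (Arc G)} {a : Arc G} :
    a ∈ revWithin hG W S ↔ flipArc hG W a ∈ S := by
  simp [revWithin]

lemma revWithin_revWithin (hG : IsBidirected G) (W : Set V) (S : Finset (Arc G)) :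
    revWithin hG W (revWithin hG W S) = S := by
  ext a
  rw [mem_revWithin, mem_revWithin, flipArc_flipArc]

lemma wt_revWithin (hG : IsBidirected G)
    (hsymm : ∀ a b : Arc G, b.src = a.tgt → b.tgt = a.src → p b = p a)
    (W : Set V) (S : Finset (Arc G)) : wt p (revWithin hG W S) = wt p S := by
  have hp : ∀ a, p (flipArc hG W a) = p a := by
    intro a
    unfold flipArc
    split_ifs
    · exact hsymm a _ rfl rfl
    · rfl
  rw [wt_eq, wt_eq]
  refine Finset.prod_bijective (flipArc hG W)
    (Function.Involutive.bijective (flipArc_flipArc hG W)) (by simp) fun a _ => ?_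
  rw [hp, ind_congr mem_revWithin, ind_congr (not_congr mem_revWithin)]

open Classical in
lemma wt_insert {T : Finset (Arc G)} {a : Arc G} (ha : a ∉ T) :
    wt p (insert a T) * p a = wt p T * (1 - p a) := by
  rw [wt_eq, wt_eq, ← Finset.mul_prod_erase _ _ (Finset.mem_univ a),
    ← Finset.mul_prod_erase Finset.univ
      (fun b => ind (b ∈ T) * (1 - p b) + ind (b ∉ T) * p b) (Finset.mem_univ a)]
  have : ∏ b ∈ Finset.univ.erase a,
      (ind (b ∈ insert a T) * (1 - p b) + ind (b ∉ insert a T) * p b)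
      = ∏ b ∈ Finset.univ.erase a, (ind (b ∈ T) * (1 - p b) + ind (b ∉ T) * p b) := by
    refine Finset.prod_congr rfl fun b hb => ?_
    have hba : b ≠ a := Finset.ne_of_mem_erase hb
    simp [hba]
  rw [this]
  simp [ind, ha]
  ring

open Classical in
/-- The arc `a` of `T` lies on every directed path of `T` from `v` to the root. -/
def IsCut (r v : V) (T : Finset (Arc G)) (a : Arc G) : Prop :=
  a ∈ T ∧ ¬ Reaches (T.erase a) v r

open Classical in
lemma IsCut.not_reaches_src {T : Finset (Arc G)} {a : Arc G} (h : IsCut r v T a)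
    (hT : RootConnected r T) : ¬ Reaches (T.erase a) a.src r := by
  intro ha
  refine h.2 ((hT v).head_rec (P := fun x => Reaches (T.erase a) x r)
    Relation.ReflTransGen.refl fun b hb _ ih => ?_)
  by_cases hba : b = a
  · rwa [hba]
  · exact reaches_step (Finset.mem_erase.2 ⟨hba, hb⟩) ih

-- Cut a path from `u` to the root at its last visit to `u`.
open Classical in
lemma exists_arc_reaches_avoiding {T : Finset (Arc G)} {u : V} (hu : Reaches T u r) (hur : u ≠ r) :
    ∃ b ∈ T, b.src = u ∧ Reaches (T.filter fun c => c.src ≠ u) b.tgt r := by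
  have key := hu.head_rec (P := fun x => Reaches (T.filter fun c => c.src ≠ u) x r ∨
    ∃ b ∈ T, b.src = u ∧ Reaches (T.filter fun c => c.src ≠ u) b.tgt r)
    (Or.inl Relation.ReflTransGen.refl) fun b hb _ ih => by
      rcases ih with ih | ih
      · by_cases hbu : b.src = u
        · exact Or.inr ⟨b, hb, hbu, ih⟩
        · exact Or.inl (reaches_step (Finset.mem_filter.2 ⟨hb, hbu⟩) ih)
      · exact Or.inr ih
  refine key.resolve_left fun h => ?_
  rcases Relation.ReflTransGen.cases_head h with h | ⟨c, ⟨b, hb, hbu, -⟩, -⟩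
  · exact hur h
  · exact (Finset.mem_filter.1 hb).2 hbu

/-- Some path from the common tail to the root leaves that tail once, by an arc `c`. A cut arc with
this tail must lie on the path, hence equals `c`. -/
lemma IsCut.src_injective {T : Finset (Arc G)} (hT : RootConnected r T) {a b : Arc G}
    (ha : IsCut r v T a) (hb : IsCut r v T b) (hab : a.src = b.src) : a = b := by
  classical
  have hr : a.src ≠ r := fun h => ha.not_reaches_src hT (by rw [h]; exact Relation.ReflTransGen.refl)
  obtain ⟨c, hc, hcu, hreach⟩ := exists_arc_reaches_avoiding (hT a.src) hr
  have key : ∀ d : Arc G, IsCut r v T d → d.src = a.src → d = c := by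
    intro d hd hda
    by_contra hne
    have hsub : Reaches (T.erase d) c.tgt r := by
      refine hreach.of_subset fun e he => ?_
      refine Finset.mem_erase.2 ⟨fun h => ?_, (Finset.mem_filter.1 he).1⟩
      exact (Finset.mem_filter.1 he).2 (by rw [h, hda])
    refine hd.not_reaches_src hT ?_
    rw [hda, ← hcu]
    exact reaches_step (Finset.mem_erase.2 ⟨Ne.symm hne, hc⟩) hsub
  rw [key a ha rfl, key b hb hab.symm]

lemma sum_ind_isCut_le {T : Finset (Arc G)} (hT : RootConnected r T) (v : V) :
    ∑ a, ind (IsCut r v T a) ≤ Fintype.card V := by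
  classical
  have h : ∑ a, ind (IsCut r v T a) = ((Finset.univ.filter fun a => IsCut r v T a).card : ℝ) := by
    rw [Finset.card_filter]
    push_cast
    exact Finset.sum_congr rfl fun a _ => by by_cases h : IsCut r v T a <;> simp [ind, h]
  rw [h, ← Finset.card_univ]
  exact_mod_cast Finset.card_le_card_of_injOn (fun a : Arc G => a.src) (by simp)
    fun a ha b hb hab => IsCut.src_injective hT (by simpa using ha) (by simpa using hb) hab

/-- A set of vertices without the root is left by an arc. -/
lemma exists_exit_arc (hG : IsBidirected G) (hconn : G.toSimpleGraphInclusive.Connected)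
    {U : Set V} (hU : U.Nonempty) (hr : r ∉ U) : ∃ a : Arc G, a.src ∈ U ∧ a.tgt ∉ U := by
  obtain ⟨x, hx⟩ := hU
  obtain ⟨w⟩ := hconn.preconnected x r
  obtain ⟨d, -, h1, h2⟩ := w.exists_boundary_dart U hx hr
  have hadj : (SimpleGraph.fromRel G.Adj).Adj d.fst d.snd := d.adj
  rw [SimpleGraph.fromRel_adj] at hadj
  exact ⟨⟨d.fst, d.snd, hadj.2.elim id (hG _ _)⟩, h1, h2⟩

open Classical in
/-- The subgraph recovered from a repaired subgraph `T`, the added arc `a` and the vertex `v`. -/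
def unrepair (hG : IsBidirected G) (v : V) (x : Finset (Arc G) × Arc G) : Finset (Arc G) :=
  revWithin hG {y | Reaches (x.1.erase x.2) v y} (x.1.erase x.2)

/-- If all clusters of `S` contain `v`, then `S` can be made root-connected by reversing some arcs
and adding one more, so that it can be recovered from the result and the added arc. -/
lemma AllThrough.exists_repair {S : Finset (Arc G)} (h : AllThrough r v ∅ S)
    (hG : IsBidirected G) (hconn : G.toSimpleGraphInclusive.Connected)
    (hsymm : ∀ a b : Arc G, b.src = a.tgt → b.tgt = a.src → p b = p a) :
    ∃ x : Finset (Arc G) × Arc G, (RootConnected r x.1 ∧ IsCut r v x.1 x.2) ∧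
      wt p x.1 * p x.2 = wt p S * (1 - p x.2) ∧ unrepair hG v x = S := by
  classical
  have hcl := h.1
  rw [meets_empty, not_not] at hcl
  set U : Set V := {x | ¬ Reaches S x r} with hU
  have hrU : r ∉ U := fun h => h Relation.ReflTransGen.refl
  have hUne : U.Nonempty := by
    by_contra hne
    rw [Set.not_nonempty_iff_eq_empty] at hne
    refine rootConnected_iff.1 (fun x => ?_) hcl
    by_contra hx
    have : x ∈ U := hx
    rw [hne] at this
    exact this
  -- For `x` in `U`, the set reachable from `x` is a cluster, so it contains `v`.
  have hUv : ∀ x ∈ U, Reaches S x v := by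
    intro x hx
    refine h.2 {y | Reaches S x y} ⟨⟨x, Relation.ReflTransGen.refl⟩, hx, fun a ha hs => ?_⟩ (by simp)
    exact Relation.ReflTransGen.tail hs ⟨a, ha, rfl, rfl⟩
  obtain ⟨a, haU, hatU⟩ := exists_exit_arc hG hconn hUne hrU
  have hat : Reaches S a.tgt r := not_not.1 hatU
  set W : Set V := {y | Reaches S a.src y} with hW
  have hWclosed : ∀ b ∈ S, b.src ∈ W → b.tgt ∈ W := fun b hb hs =>
    Relation.ReflTransGen.tail hs ⟨b, hb, rfl, rfl⟩
  have hWU : ∀ y ∈ W, y ∈ U := fun y hy hyr => haU (Relation.ReflTransGen.trans hy hyr)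
  have hvW : v ∈ W := hUv _ haU
  set T := revWithin hG W S with hT
  have hflip : ∀ b : Arc G, ¬ (b.src ∈ W ∧ b.tgt ∈ W) → flipArc hG W b = b := fun b hb => by
    simp only [flipArc, if_neg hb]
  have haT : a ∉ T := by
    rw [hT, mem_revWithin, hflip a fun h' => hatU (hWU _ h'.2)]
    exact fun haS => haU (reaches_step haS hat)
  -- `W` is closed under the arcs of `S`, so a path starting in `W` stays inside and is reversed as
  -- a whole.
  have hrev : ∀ x y, x ∈ W → Reaches S x y → Reaches T y x := by
    intro x y hx hxy
    induction hxy with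
    | refl => exact Relation.ReflTransGen.refl
    | tail h1 h2 ih =>
      obtain ⟨b, hb, rfl, rfl⟩ := h2
      have hs : b.src ∈ W := Reaches.closed h1 hWclosed hx
      have htw : twin hG b ∈ T := by
        rw [hT, mem_revWithin]
        simpa [flipArc, twin, hs, hWclosed b hb hs] using hb
      exact reaches_step htw ih
  -- This makes the map invertible: without `a`, the vertex `v` reaches exactly `W`, so the reversed
  -- region can be read off from the result.
  have hreach : {y | Reaches T v y} = W := by
    refine Set.Subset.antisymm (fun y hy => ?_) fun y hy => hrev y v hy (hUv y (hWU y hy))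
    refine Reaches.closed hy (fun b hb hs => ?_) hvW
    by_contra ht
    rw [hT, mem_revWithin, hflip b fun h' => ht h'.2] at hb
    exact ht (hWclosed b hb hs)
  have herase : (insert a T).erase a = T := Finset.erase_insert haT
  have hmono : ∀ {x y}, Reaches T x y → Reaches (insert a T) x y := fun {x y} hxy =>
    hxy.of_subset (Finset.subset_insert a T)
  have hstay : ∀ b ∈ S, b.src ∉ W → b ∈ insert a T := fun b hb hs => by
    refine Finset.mem_insert_of_mem ?_
    rw [hT, mem_revWithin, hflip b fun h' => hs h'.1]
    exact hb
  -- A path of `S` to the root never enters `W`, so its arcs are untouched by the reversal.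
  have hout : ∀ x, Reaches S x r → Reaches (insert a T) x r := fun x hx =>
    hx.head_rec (P := fun x => Reaches (insert a T) x r) Relation.ReflTransGen.refl
      fun b hb h1 ih => reaches_step (hstay b hb fun hs => hWU _ hs (reaches_step hb h1)) ih
  have hinW : ∀ x ∈ W, Reaches (insert a T) x r := fun x hx =>
    Relation.ReflTransGen.trans (hmono (hrev a.src x Relation.ReflTransGen.refl hx))
      (reaches_step (Finset.mem_insert_self a T) (hout _ hat))
  refine ⟨(insert a T, a), ⟨fun x => ?_, Finset.mem_insert_self a T, ?_⟩, ?_, ?_⟩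
  · by_cases hx : Reaches S x r
    · exact hout x hx
    · refine (hUv x hx).head_rec (P := fun x => Reaches (insert a T) x r) (hinW v hvW)
        fun b hb _ ih => ?_
      by_cases hs : b.src ∈ W
      · exact hinW _ hs
      · exact reaches_step (hstay b hb hs) ih
  · rw [herase]
    intro hvr
    have : r ∈ W := hreach ▸ hvr
    exact hrU (hWU r this)
  · rw [wt_insert haT, hT, wt_revWithin hG hsymm]
  · simp only [unrepair]
    rw [herase, hreach, hT, revWithin_revWithin]

/-- The repair map bounds the weight of the subgraphs with all clusters through `v`. -/
lemma prob_allThrough_le (hG : IsBidirected G) (hconn : G.toSimpleGraphInclusive.Connected)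
    {q : ℝ} (hp0 : ∀ a, 0 ≤ p a) (hpq : ∀ a, p a ≤ q) (hq : q < 1)
    (hsymm : ∀ a b : Arc G, b.src = a.tgt → b.tgt = a.src → p b = p a) (v : V) :
    prob p (AllThrough r v ∅)
      ≤ ∑ T, ∑ a, ind (RootConnected r T ∧ IsCut r v T a) * (wt p T * (q / (1 - q))) := by
  classical
  have hp : UnitRange p := fun a => ⟨hp0 a, (hpq a).trans hq.le⟩
  -- `choose!` below needs an inhabited type of values, hence an arc.
  rcases isEmpty_or_nonempty (Arc G) with hA | hA
  · rw [prob, Finset.sum_eq_zero fun S _ => ?_]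
    · simp
    · rw [ind_of_false fun h => ?_, mul_zero]
      obtain ⟨x, -⟩ := h.exists_repair hG hconn hsymm
      exact hA.elim x.2
  choose! φ hφ using fun (S : Finset (Arc G)) (h : AllThrough r v ∅ S) =>
    h.exists_repair hG hconn hsymm
  have h1 : prob p (AllThrough r v ∅)
      = ∑ S ∈ Finset.univ.filter (fun S : Finset (Arc G) => AllThrough r v ∅ S), wt p S := by
    rw [prob, Finset.sum_filter]
    exact Finset.sum_congr rfl fun S _ => by by_cases h : AllThrough r v ∅ S <;> simp [ind, h]
  rw [h1, ← Finset.sum_product', Finset.univ_product_univ]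
  set g : Finset (Arc G) × Arc G → ℝ := fun x =>
    ind (RootConnected r x.1 ∧ IsCut r v x.1 x.2) * (wt p x.1 * (q / (1 - q))) with hg
  have hq0 : ∀ a : Arc G, 0 ≤ q / (1 - q) := fun a =>
    div_nonneg ((hp0 a).trans (hpq a)) (by linarith)
  have hg0 : ∀ x, 0 ≤ g x := fun x =>
    mul_nonneg (ind_nonneg _) (mul_nonneg (wt_nonneg hp _) (hq0 x.2))
  calc ∑ S ∈ Finset.univ.filter (fun S : Finset (Arc G) => AllThrough r v ∅ S), wt p S
      ≤ ∑ S ∈ Finset.univ.filter (fun S : Finset (Arc G) => AllThrough r v ∅ S), g (φ S) := by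
        refine Finset.sum_le_sum fun S hS => ?_
        obtain ⟨h2, h3, -⟩ := hφ S (Finset.mem_filter.1 hS).2
        rw [hg]
        simp only
        rw [ind_of_true h2, one_mul]
        have hpos : 0 < 1 - p (φ S).2 := by linarith [hpq (φ S).2]
        have : wt p S = wt p (φ S).1 * (p (φ S).2 / (1 - p (φ S).2)) := by
          field_simp
          linarith
        rw [this]
        refine mul_le_mul_of_nonneg_left ?_ (wt_nonneg hp _)
        exact div_le_div₀ ((hp0 (φ S).2).trans (hpq _)) (hpq _) (by linarith) (by linarith [hpq (φ S).2])
    _ = ∑ x ∈ (Finset.univ.filter (fun S : Finset (Arc G) => AllThrough r v ∅ S)).image φ, g x := by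
        rw [Finset.sum_image]
        intro S hS T hT hST
        rw [← (hφ S (by simpa using hS)).2.2, ← (hφ T (by simpa using hT)).2.2, hST]
    _ ≤ ∑ x, g x := Finset.sum_le_sum_of_subset_of_nonneg (Finset.subset_univ _) fun x _ _ => hg0 x

/-- The weight of the subgraphs with all clusters through `v` is at most `q n / (1 - q)` times the
weight of the root-connected ones. -/
lemma prob_allThrough_le_card (hG : IsBidirected G) (hconn : G.toSimpleGraphInclusive.Connected)
    {q : ℝ} (hp0 : ∀ a, 0 ≤ p a) (hpq : ∀ a, p a ≤ q) (hq0 : 0 ≤ q) (hq : q < 1)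
    (hsymm : ∀ a b : Arc G, b.src = a.tgt → b.tgt = a.src → p b = p a) (v : V) :
    prob p (AllThrough r v ∅) ≤ q / (1 - q) * Fintype.card V * prob p (Meets r ∅) := by
  refine (prob_allThrough_le hG hconn hp0 hpq hq hsymm v).trans ?_
  have hp : UnitRange p := fun a => ⟨hp0 a, (hpq a).trans hq.le⟩
  rw [prob, Finset.mul_sum]
  refine Finset.sum_le_sum fun T _ => ?_
  rw [ind_congr (meets_empty.trans rootConnected_iff.symm)]
  by_cases hT : RootConnected r T
  · rw [ind_of_true hT, mul_one]
    have := sum_ind_isCut_le hT v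
    have hρ : 0 ≤ q / (1 - q) := div_nonneg hq0 (by linarith)
    calc ∑ a, ind (RootConnected r T ∧ IsCut r v T a) * (wt p T * (q / (1 - q)))
        = (∑ a, ind (IsCut r v T a)) * (wt p T * (q / (1 - q))) := by
          rw [Finset.sum_mul]
          exact Finset.sum_congr rfl fun a _ => by rw [ind_and, ind_of_true hT, one_mul]
      _ ≤ Fintype.card V * (wt p T * (q / (1 - q))) :=
          mul_le_mul_of_nonneg_right this (mul_nonneg (wt_nonneg hp T) hρ)
      _ = _ := by ring
  · rw [ind_of_false hT]
    simp only [ind_and, ind_of_false hT, zero_mul, Finset.sum_const_zero, mul_zero]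
    exact le_rfl

/-- The full arc set has no cluster, and its weight is positive. -/
lemma prob_meets_pos (hG : IsBidirected G) (hconn : G.toSimpleGraphInclusive.Connected)
    (hp : ∀ a, 0 ≤ p a ∧ p a < 1) : 0 < prob p (Meets r ∅) := by
  have hp' : UnitRange p := fun a => ⟨(hp a).1, (hp a).2.le⟩
  have hM : Meets r ∅ (Finset.univ : Finset (Arc G)) := by
    rw [meets_empty]
    rintro ⟨C, hne, hr, hC⟩
    obtain ⟨a, h1, h2⟩ := exists_exit_arc hG hconn hne hr
    exact h2 (hC a (Finset.mem_univ a) h1)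
  refine lt_of_lt_of_le ?_ (Finset.single_le_sum
    (f := fun S => wt p S * ind (Meets r ∅ S))
    (fun S _ => mul_nonneg (wt_nonneg hp' S) (ind_nonneg _)) (Finset.mem_univ Finset.univ))
  rw [ind_of_true hM, mul_one, wt_eq]
  exact Finset.prod_pos fun a _ => by simp [ind, (hp a).2]

lemma sum_prob_allThrough_le (hG : IsBidirected G) (hconn : G.toSimpleGraphInclusive.Connected)
    {q : ℝ} (hp0 : ∀ a, 0 < p a) (hpq : ∀ a, p a ≤ q) (hq : q < 1)
    (hsymm : ∀ a b : Arc G, b.src = a.tgt → b.tgt = a.src → p b = p a) :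
    ∑ a : Arc G, prob p (AllThrough r a.src ∅) / prob p (Meets r ∅)
      ≤ q * Nat.card (Arc G) * Nat.card V / (1 - q) := by
  have hZ := prob_meets_pos (r := r) hG hconn fun a => ⟨(hp0 a).le, (hpq a).trans_lt hq⟩
  have h : ∀ a : Arc G, prob p (AllThrough r a.src ∅) / prob p (Meets r ∅)
      ≤ q / (1 - q) * Nat.card V := by
    intro a
    rw [div_le_iff₀ hZ, Nat.card_eq_fintype_card]
    exact prob_allThrough_le_card hG hconn (fun a => (hp0 a).le) hpq ((hp0 a).le.trans (hpq a)) hq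
      hsymm a.src
  refine (Finset.sum_le_sum fun a _ => h a).trans_eq ?_
  rw [Finset.sum_const, Finset.card_univ, ← Nat.card_eq_fintype_card, nsmul_eq_mul]
  ring

end UpperBound

/-! ### Independence of disjoint pairs of arcs. -/

section TwoStep

variable {V : Type*} [Fintype V] {G : Digraph V}

/-- Among disjoint pairs of arcs, the probability that none is present as a whole. -/
lemma prob_no_pair (q : ℝ) {ι : Type*} (s : Finset ι) (α β : ι → Arc G)
    (hα : Function.Injective α) (hβ : Function.Injective β) (hαβ : ∀ i j, α i ≠ β j) :
    prob (fun _ => q) (fun S => ∀ i ∈ s, ¬ (α i ∈ S ∧ β i ∈ S)) = (1 - (1 - q) ^ 2) ^ s.card := by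
  classical
  induction s using Finset.induction_on with
  | empty => simpa using prob_true (fun _ : Arc G => q)
  | insert i s hi ih =>
    have h1 : LocalOn {α i, β i} fun S : Finset (Arc G) => ¬ (α i ∈ S ∧ β i ∈ S) := fun S T h => by
      beta_reduce
      rw [h (α i) (by simp), h (β i) (by simp)]
    have h2 : LocalOn ({α i, β i} : Set (Arc G))ᶜ
        fun S : Finset (Arc G) => ∀ j ∈ s, ¬ (α j ∈ S ∧ β j ∈ S) := fun S T h => by
      refine forall_congr' fun j => imp_congr_right fun hj => ?_
      have hji : j ≠ i := fun h => hi (h ▸ hj)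
      rw [h (α j) (by simp [hα.ne hji, hαβ]), h (β j) (by simp [hβ.ne hji, (hαβ _ _).symm])]
    have h3 : prob (fun _ => q) (fun S => ¬ (α i ∈ S ∧ β i ∈ S)) = 1 - (1 - q) ^ 2 := by
      rw [prob_not]
      have := prob_pattern (fun _ : Arc G => q) {α i, β i} ∅ (by simp)
      rw [Finset.prod_const, Finset.card_pair (hαβ i i)] at this
      simp only [Finset.prod_empty, mul_one] at this
      rw [← this]
      congr 1
      exact prob_congr fun S => by simp
    rw [Finset.card_insert_of_notMem hi, pow_succ', ← ih, ← h3, ← prob_and h1 h2]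
    exact prob_congr fun S => by simp

end TwoStep

/-! ### The lower bound for the pops of a clique vertex of the lollipop. -/

section Lollipop

variable {n₁ n₂ : ℕ} {r : Fin (n₁ + n₂)}

lemma isBidirected_lollipop : IsBidirected (lollipop n₁ n₂) := fun u v h =>
  ⟨h.1.symm, by
    rcases h.2 with h | h | h
    · exact Or.inr (Or.inl h)
    · exact Or.inl h
    · exact Or.inr (Or.inr h.symm)⟩

lemma connected_lollipop (h₂ : 0 < n₂) : (lollipop n₁ n₂).toSimpleGraphInclusive.Connected := by
  have hadj : ∀ u v, (lollipop n₁ n₂).Adj u v →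
      (lollipop n₁ n₂).toSimpleGraphInclusive.Adj u v := fun u v h => ⟨h.1, Or.inl h⟩
  have key : ∀ (n : ℕ) (x : Fin (n₁ + n₂)), (x : ℕ) = n →
      (lollipop n₁ n₂).toSimpleGraphInclusive.Reachable x ⟨0, by omega⟩ := by
    intro n
    induction n using Nat.strong_induction_on with
    | _ n ih =>
      intro x hx
      by_cases h0 : n = 0
      · have : x = ⟨0, by omega⟩ := Fin.ext (by simp [hx, h0])
        rw [this]
      · by_cases hn : n ≤ n₁
        · refine (hadj x ⟨n - 1, by omega⟩ ⟨?_, Or.inr (Or.inl ?_)⟩).reachable.trans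
            (ih (n - 1) (by omega) _ rfl)
          · intro h
            have := congrArg Fin.val h
            simp only at this
            omega
          · simp only
            omega
        · refine (hadj x ⟨n₁, by omega⟩ ⟨?_, Or.inr (Or.inr ⟨by omega, le_rfl⟩)⟩).reachable.trans
            (ih n₁ (by omega) _ rfl)
          intro h
          have := congrArg Fin.val h
          simp only at this
          omega
  have : Nonempty (Fin (n₁ + n₂)) := ⟨⟨0, by omega⟩⟩
  exact ⟨fun x y => (key _ x rfl).trans (key _ y rfl).symm⟩

/-- The path arc from `i + 1` to `i`. -/
def downArc (h₂ : 0 < n₂) (i : Fin n₁) : Arc (lollipop n₁ n₂) where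
  src := ⟨i + 1, by omega⟩
  tgt := ⟨i, by omega⟩
  adj := ⟨by simp, Or.inr (Or.inl rfl)⟩

/-- The path arc from `i` to `i + 1`. -/
def upArc (h₂ : 0 < n₂) (i : Fin n₁) : Arc (lollipop n₁ n₂) where
  src := ⟨i, by omega⟩
  tgt := ⟨i + 1, by omega⟩
  adj := ⟨by simp, Or.inl rfl⟩

/-- The clique arc from the `i`-th to the `j`-th clique vertex. -/
def cliqueArc {i j : Fin n₂} (h : i ≠ j) : Arc (lollipop n₁ n₂) where
  src := Fin.natAdd n₁ i
  tgt := Fin.natAdd n₁ j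
  adj := ⟨fun h' => h (Fin.natAdd_injective _ _ h'), Or.inr (Or.inr ⟨by simp, by simp⟩)⟩

/-- The arc from `i + 1` to `i` is the only exit from the vertices above `i`. -/
lemma hasCluster_of_downArc_notMem {h₂ : 0 < n₂} (hr : (r : ℕ) = 0) {i : Fin n₁}
    {S : Finset (Arc (lollipop n₁ n₂))} (h : downArc h₂ i ∉ S) : HasCluster r S := by
  refine ⟨{x | (i : ℕ) + 1 ≤ x}, ⟨⟨i + 1, by omega⟩, by simp⟩, by simp [hr], fun a ha hs => ?_⟩
  by_contra ht
  simp only [Set.mem_ofPred_eq, not_le] at hs ht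
  refine h ?_
  have h2 : (a.tgt : ℕ) + 1 = a.src := by
    rcases a.adj.2 with h | h | h <;> omega
  have : downArc h₂ i = a := by
    apply Arc.ext
    · exact Fin.ext (by simp only [downArc]; omega)
    · exact Fin.ext (by simp only [downArc]; omega)
  rwa [this]

/-- Any two distinct clique vertices are joined by a directed path of length two in the clique. -/
def TwoStepClique (S : Finset (Arc (lollipop n₁ n₂))) : Prop :=
  ∀ i j : Fin n₂, i ≠ j → ∃ (k : Fin n₂) (hi : i ≠ k) (hj : k ≠ j),
    cliqueArc hi ∈ S ∧ cliqueArc hj ∈ S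

/-- The arc `i + 1 → i` is absent, the arcs below it lead down and those above it lead up. -/
def BreakAt (h₂ : 0 < n₂) (i : Fin n₁) (S : Finset (Arc (lollipop n₁ n₂))) : Prop :=
  (∀ j, (j < i → downArc h₂ j ∈ S) ∧ (i < j → upArc h₂ j ∈ S)) ∧ downArc h₂ i ∉ S

/-- A cluster with a vertex at or below `i` would slide down to the root; from a path vertex above
`i` it climbs to the clique, and there it reaches `v` in at most two steps. -/
lemma BreakAt.allThrough {h₂ : 0 < n₂} (hr : (r : ℕ) = 0) {i : Fin n₁}
    {S : Finset (Arc (lollipop n₁ n₂))} (h : BreakAt h₂ i S) (hS : TwoStepClique S)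
    (v : Fin (n₁ + n₂)) (hv : n₁ ≤ (v : ℕ)) : AllThrough r v ∅ S := by
  have hc : HasCluster r S := hasCluster_of_downArc_notMem hr h.2
  refine ⟨by rwa [meets_empty, not_not], fun C hC _ => ?_⟩
  have hclique : ∀ x ∈ C, n₁ ≤ (x : ℕ) → v ∈ C := by
    intro x hx hxn
    by_cases hxv : x = v
    · rwa [← hxv]
    obtain ⟨i', rfl⟩ : ∃ i', x = Fin.natAdd n₁ i' :=
      ⟨⟨x - n₁, by omega⟩, Fin.ext (by simp; omega)⟩
    obtain ⟨j', rfl⟩ : ∃ j', v = Fin.natAdd n₁ j' :=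
      ⟨⟨v - n₁, by omega⟩, Fin.ext (by simp; omega)⟩
    obtain ⟨k, hi, hj, h1, h2⟩ := hS i' j' fun h => hxv (by rw [h])
    exact hC.2.2 _ h2 (hC.2.2 _ h1 hx)
  have hdown : ∀ n, ∀ x ∈ C, (x : ℕ) = n → ¬ n ≤ (i : ℕ) := by
    intro n
    induction n with
    | zero =>
      intro x hx hxn _
      have : x = r := Fin.ext (by rw [hxn, hr])
      exact hC.2.1 (this ▸ hx)
    | succ n ih =>
      intro x hx hxn hn
      have hx' : x = (downArc h₂ ⟨n, by omega⟩ : Arc (lollipop n₁ n₂)).src := Fin.ext hxn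
      exact ih _ (hC.2.2 _ ((h.1 ⟨n, by omega⟩).1 (Fin.lt_def.2 (by simp only; omega)))
        (hx' ▸ hx)) rfl (by omega)
  have hup : ∀ d, ∀ x ∈ C, (x : ℕ) + d = n₁ → v ∈ C := by
    intro d
    induction d with
    | zero => exact fun x hx hxn => hclique x hx (by omega)
    | succ d ih =>
      intro x hx hxn
      have hxi := hdown x x hx rfl
      have hx' : x = (upArc h₂ ⟨x, by omega⟩ : Arc (lollipop n₁ n₂)).src := Fin.ext rfl
      exact ih _ (hC.2.2 _ ((h.1 ⟨x, by omega⟩).2 (Fin.lt_def.2 (by simp only; omega)))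
        (hx' ▸ hx)) (by simp only [upArc]; omega)
  obtain ⟨x, hx⟩ := hC.1
  by_cases hxn : n₁ ≤ (x : ℕ)
  · exact hclique x hx hxn
  · exact hup (n₁ - x) x hx (by omega)

lemma downArc_injective (h₂ : 0 < n₂) : Function.Injective (downArc (n₁ := n₁) h₂) := by
  intro i j h
  have := congrArg (fun a => (a.tgt : ℕ)) h
  exact Fin.ext this

lemma prob_breakAt (q : ℝ) (h₂ : 0 < n₂) (i : Fin n₁) :
    prob (fun _ => q) (BreakAt h₂ i) = (1 - q) ^ (n₁ - 1) * q := by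
  classical
  set f : Fin n₁ → Arc (lollipop n₁ n₂) := fun j => if j < i then downArc h₂ j else upArc h₂ j
    with hf
  have hinj : Function.Injective f := by
    intro j k hjk
    -- The sum of the two ends is `2 j + 1` for either direction, so it identifies the path edge.
    have h1 := congrArg (fun a => (a.src : ℕ) + a.tgt) hjk
    simp only [hf] at h1
    split_ifs at h1 <;> simp only [downArc, upArc] at h1 <;> exact Fin.ext (by omega)
  have hdisj : Disjoint ((Finset.univ.erase i).image f) {downArc h₂ i} := by
    rw [Finset.disjoint_singleton_right, Finset.mem_image]
    rintro ⟨j, hj, hji⟩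
    have hne : j ≠ i := Finset.ne_of_mem_erase hj
    have h1 := congrArg (fun a => (a.src : ℕ) + a.tgt) hji
    simp only [hf] at h1
    refine hne (Fin.ext ?_)
    split_ifs at h1 <;> simp only [downArc, upArc] at h1 <;> omega
  have := prob_pattern (fun _ => q) _ _ hdisj
  rw [Finset.prod_const, Finset.prod_const, Finset.card_image_of_injective _ hinj,
    Finset.card_erase_of_mem (Finset.mem_univ i), Finset.card_univ, Fintype.card_fin,
    Finset.card_singleton, pow_one] at this
  rw [← this]
  refine prob_congr fun S => and_congr ?_ (by simp)
  simp only [Finset.mem_image, Finset.mem_erase, Finset.mem_univ, and_true,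
    forall_exists_index, and_imp, forall_apply_eq_imp_iff₂]
  refine forall_congr' fun j => ?_
  rcases lt_trichotomy j i with h | h | h
  · simp [hf, h, h.ne, h.not_gt]
  · simp [h]
  · simp [hf, h, h.ne', h.not_gt]

lemma localOn_twoStepClique :
    LocalOn {a : Arc (lollipop n₁ n₂) | n₁ ≤ (a.src : ℕ) ∧ n₁ ≤ (a.tgt : ℕ)} TwoStepClique := by
  intro S T h
  refine forall_congr' fun i => forall_congr' fun j => imp_congr_right fun _ =>
    exists_congr fun k => exists_congr fun hi => exists_congr fun hj => ?_
  rw [h (cliqueArc hi) ⟨by simp [cliqueArc], by simp [cliqueArc]⟩,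
    h (cliqueArc hj) ⟨by simp [cliqueArc], by simp [cliqueArc]⟩]

lemma localOn_breakAt (h₂ : 0 < n₂) (i : Fin n₁) :
    LocalOn {a : Arc (lollipop n₁ n₂) | n₁ ≤ (a.src : ℕ) ∧ n₁ ≤ (a.tgt : ℕ)}ᶜ (BreakAt h₂ i) := by
  intro S T h
  have hd : ∀ j, downArc h₂ j ∈ S ↔ downArc h₂ j ∈ T := fun j => h _ fun h' => by
    have := h'.2
    simp only [downArc] at this
    omega
  have hu : ∀ j, upArc h₂ j ∈ S ↔ upArc h₂ j ∈ T := fun j => h _ fun h' => by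
    have := h'.1
    simp only [upArc] at this
    omega
  simp only [BreakAt, hd, hu]

lemma prob_meets_lollipop_le {q : ℝ} (hq : 0 ≤ q ∧ q ≤ 1) (h₂ : 0 < n₂) (hr : (r : ℕ) = 0) :
    prob (G := lollipop n₁ n₂) (fun _ => q) (Meets r ∅) ≤ (1 - q) ^ n₁ := by
  classical
  have := prob_pattern (fun _ : Arc (lollipop n₁ n₂) => q) (Finset.univ.image (downArc h₂)) ∅
    (by simp)
  rw [Finset.prod_const, Finset.card_image_of_injective _ (downArc_injective h₂), Finset.card_univ,
    Fintype.card_fin, Finset.prod_empty, mul_one] at this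
  rw [← this]
  refine prob_mono (fun _ => hq) fun S hS => ⟨?_, by simp⟩
  intro a ha
  obtain ⟨i, -, rfl⟩ := Finset.mem_image.1 ha
  by_contra h
  exact meets_empty.1 hS (hasCluster_of_downArc_notMem hr h)

/-- The `n₁` break events are disjoint and independent of the clique. Each has weight `(1 - q) ^ (n₁
- 1) * q`, while root-connectedness needs all `n₁` downward arcs. -/
lemma le_prob_allThrough_div {q : ℝ} (hq0 : 0 < q) (hq1 : q < 1) (h₂ : 0 < n₂) (hr : (r : ℕ) = 0)
    (v : Fin (n₁ + n₂)) (hv : n₁ ≤ (v : ℕ)) :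
    n₁ * (q / (1 - q)) * prob (G := lollipop n₁ n₂) (fun _ => q) TwoStepClique
      ≤ prob (G := lollipop n₁ n₂) (fun _ => q) (AllThrough r v ∅)
        / prob (G := lollipop n₁ n₂) (fun _ => q) (Meets r ∅) := by
  have hp : UnitRange fun _ : Arc (lollipop n₁ n₂) => q := fun _ => ⟨hq0.le, hq1.le⟩
  set P := prob (G := lollipop n₁ n₂) (fun _ => q) TwoStepClique with hP
  have hP0 : 0 ≤ P := prob_nonneg hp _
  have hZ : 0 < prob (G := lollipop n₁ n₂) (fun _ => q) (Meets r ∅) :=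
    prob_meets_pos isBidirected_lollipop (connected_lollipop h₂) fun _ => ⟨hq0.le, hq1⟩
  have h1 : n₁ * ((1 - q) ^ (n₁ - 1) * q * P)
      ≤ prob (G := lollipop n₁ n₂) (fun _ => q) (AllThrough r v ∅) := by
    have := sum_prob_le hp (Finset.univ : Finset (Fin n₁))
      (fun i S => TwoStepClique S ∧ BreakAt h₂ i S) (AllThrough r v ∅)
      (fun i _ S hS => hS.2.allThrough hr hS.1 v hv) (fun i _ j _ S hi hj => by
        rcases lt_trichotomy i j with h | h | h
        · exact (hi.2.2 ((hj.2.1 i).1 h)).elim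
        · exact h
        · exact (hj.2.2 ((hi.2.1 j).1 h)).elim)
    simp_rw [prob_and localOn_twoStepClique (localOn_breakAt h₂ _), prob_breakAt] at this
    rw [Finset.sum_const, Finset.card_univ, Fintype.card_fin, nsmul_eq_mul] at this
    rwa [mul_comm P] at this
  rw [le_div_iff₀ hZ]
  refine le_trans ?_ h1
  rcases Nat.eq_zero_or_pos n₁ with h0 | h0
  · simp [h0]
  have hq : 0 < 1 - q := by linarith
  calc n₁ * (q / (1 - q)) * P * prob (G := lollipop n₁ n₂) (fun _ => q) (Meets r ∅)
      ≤ n₁ * (q / (1 - q)) * P * (1 - q) ^ n₁ :=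
        mul_le_mul_of_nonneg_left (prob_meets_lollipop_le ⟨hq0.le, hq1.le⟩ h₂ hr) (by positivity)
    _ = n₁ * ((1 - q) ^ (n₁ - 1) * q * P) := by
        obtain ⟨m, rfl⟩ : ∃ m, n₁ = m + 1 := ⟨n₁ - 1, by omega⟩
        rw [Nat.add_sub_cancel, pow_succ]
        field_simp

/-- Union bound over ordered pairs; each pair has `n₂ - 2` midpoints using disjoint pairs of arcs.
-/
lemma le_prob_twoStepClique {q : ℝ} (hq : 0 ≤ q ∧ q ≤ 1) :
    1 - (n₂ : ℝ) ^ 2 * (1 - (1 - q) ^ 2) ^ (n₂ - 2)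
      ≤ prob (G := lollipop n₁ n₂) (fun _ => q) TwoStepClique := by
  classical
  have hp : UnitRange fun _ : Arc (lollipop n₁ n₂) => q := fun _ => hq
  have hc0 : 0 ≤ 1 - (1 - q) ^ 2 := by nlinarith [hq.1, hq.2]
  have hc1 : 1 - (1 - q) ^ 2 ≤ 1 := by nlinarith [sq_nonneg (1 - q)]
  have h1 := prob_not (p := fun _ : Arc (lollipop n₁ n₂) => q) TwoStepClique
  have h2 : prob (G := lollipop n₁ n₂) (fun _ => q) (fun S => ¬ TwoStepClique S)
      ≤ ∑ x ∈ (Finset.univ : Finset (Fin n₂)).offDiag,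
        prob (G := lollipop n₁ n₂) (fun _ => q) (fun S => ∀ (k : Fin n₂) (hi : x.1 ≠ k)
          (hj : k ≠ x.2), ¬ (cliqueArc hi ∈ S ∧ cliqueArc hj ∈ S)) := by
    refine le_trans (prob_mono hp fun S hS => ?_) (prob_exists_le hp _ _)
    unfold TwoStepClique at hS
    push Not at hS
    obtain ⟨i, j, hij, h⟩ := hS
    exact ⟨(i, j), by simpa using hij, fun k hi hj h' => h k hi hj h'.1 h'.2⟩
  have h3 : ∀ x ∈ (Finset.univ : Finset (Fin n₂)).offDiag,
      prob (G := lollipop n₁ n₂) (fun _ => q) (fun S => ∀ (k : Fin n₂) (hi : x.1 ≠ k)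
          (hj : k ≠ x.2), ¬ (cliqueArc hi ∈ S ∧ cliqueArc hj ∈ S))
        ≤ (1 - (1 - q) ^ 2) ^ (n₂ - 2) := by
    rintro ⟨i, j⟩ hij
    have hcard : n₂ - 2 ≤ (Finset.univ : Finset {k : Fin n₂ // i ≠ k ∧ k ≠ j}).card := by
      rw [Finset.card_univ, Fintype.card_subtype]
      have h4 : Finset.univ \ {i, j} ⊆ (Finset.univ.filter fun k : Fin n₂ => i ≠ k ∧ k ≠ j) := by
        intro k hk
        simp only [Finset.mem_sdiff, Finset.mem_univ, Finset.mem_insert, Finset.mem_singleton,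
          true_and, not_or] at hk
        simp [hk.2, Ne.symm hk.1]
      refine le_trans ?_ (Finset.card_le_card h4)
      rw [Finset.card_sdiff_of_subset (Finset.subset_univ _), Finset.card_univ, Fintype.card_fin]
      have := Finset.card_le_two (a := i) (b := j)
      omega
    refine le_trans (le_of_eq ?_) (pow_le_pow_of_le_one hc0 hc1 hcard)
    rw [← prob_no_pair q (Finset.univ : Finset {k : Fin n₂ // i ≠ k ∧ k ≠ j})
      (fun k => cliqueArc (n₁ := n₁) k.2.1) (fun k => cliqueArc (n₁ := n₁) k.2.2)]
    · exact prob_congr fun S => by simp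
    · intro k l h
      exact Subtype.ext (Fin.natAdd_injective _ _ (congrArg Arc.tgt h))
    · intro k l h
      exact Subtype.ext (Fin.natAdd_injective _ _ (congrArg Arc.src h))
    · intro k l h
      exact l.2.1 (Fin.natAdd_injective _ _ (congrArg Arc.src h))
  have h5 := h2.trans (Finset.sum_le_sum h3)
  rw [Finset.sum_const, nsmul_eq_mul, Finset.offDiag_card, Finset.card_univ, Fintype.card_fin] at h5
  have h6 : ((n₂ * n₂ - n₂ : ℕ) : ℝ) ≤ (n₂ : ℝ) ^ 2 := by
    rw [sq]
    exact_mod_cast Nat.sub_le _ _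
  have h7 := mul_le_mul_of_nonneg_right h6 (pow_nonneg hc0 (n₂ - 2))
  linarith

lemma card_arc_lollipop_ge : n₂ * n₂ - n₂ ≤ Fintype.card (Arc (lollipop n₁ n₂)) := by
  classical
  have : Fintype.card {x : Fin n₂ × Fin n₂ // x.1 ≠ x.2} = n₂ * n₂ - n₂ := by
    have h := Finset.offDiag_card (Finset.univ : Finset (Fin n₂))
    rw [Finset.card_univ, Fintype.card_fin] at h
    rw [← h, Fintype.card_subtype]
    congr 1
    ext x
    simp
  rw [← this]
  refine Fintype.card_le_of_injective (fun x => cliqueArc x.2) fun x y h => ?_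
  exact Subtype.ext (Prod.ext (Fin.natAdd_injective _ _ (congrArg Arc.src h))
    (Fin.natAdd_injective _ _ (congrArg Arc.tgt h)))

lemma sum_path_arcs_le :
    ∑ a : Arc (lollipop n₁ n₂), ind (¬ n₁ ≤ (a.src : ℕ)) ≤ 2 * n₁ := by
  classical
  have h : ∑ a : Arc (lollipop n₁ n₂), ind (¬ n₁ ≤ (a.src : ℕ))
      = ((Finset.univ.filter fun a : Arc (lollipop n₁ n₂) => ¬ n₁ ≤ (a.src : ℕ)).card : ℝ) := by
    rw [Finset.card_filter]
    push_cast
    exact Finset.sum_congr rfl fun a _ => by by_cases h : n₁ ≤ (a.src : ℕ) <;> simp [ind, h]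
  have h2 : (Finset.univ.filter fun a : Arc (lollipop n₁ n₂) => ¬ n₁ ≤ (a.src : ℕ)).card
      ≤ (Finset.range n₁ ×ˢ (Finset.univ : Finset Bool)).card := by
    -- An arc whose tail is on the path below the clique is determined by its tail and its
    -- direction.
    refine Finset.card_le_card_of_injOn
      (fun a => ((a.src : ℕ), decide ((a.src : ℕ) < a.tgt))) ?_ ?_
    · intro a ha
      simp only [Finset.coe_filter, Finset.mem_univ, true_and, Set.mem_ofPred_eq, not_le] at ha
      simpa [ha] using lt_or_ge a.src a.tgt
    · intro a ha b hb hab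
      simp only [Finset.coe_filter, Finset.mem_univ, true_and, Set.mem_ofPred_eq, not_le] at ha hb
      simp only [Prod.mk.injEq, decide_eq_decide] at hab
      refine Arc.ext (Fin.ext hab.1) (Fin.ext ?_)
      have h3 := a.adj.2
      have h4 := b.adj.2
      omega
  rw [Finset.card_product, Finset.card_range, Finset.card_univ, Fintype.card_bool] at h2
  rw [h]
  have : ((n₁ * 2 : ℕ) : ℝ) = 2 * n₁ := by push_cast; ring
  rw [← this]
  exact_mod_cast h2

end Lollipop

/-! ### Vanishing of the relative defect as the clique grows. -/

section Asymptotics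

lemma one_sub_mul_le {a b c : ℝ} (ha0 : 0 ≤ a) (ha : a ≤ 1) (hb0 : 0 ≤ b) (hb : b ≤ 1)
    (hc : c ≤ 1) : 1 - a * b * c ≤ (1 - a) + (1 - b) + (1 - c) := by
  have hab0 : 0 ≤ a * b := mul_nonneg ha0 hb0
  have hab : a * b ≤ 1 := mul_le_one₀ ha hb0 hb
  nlinarith [mul_nonneg (sub_nonneg.2 ha) (sub_nonneg.2 hb),
    mul_nonneg (sub_nonneg.2 hab) (sub_nonneg.2 hc)]

/-- The relative defect of the bound on the lollipop. -/
lemma one_sub_ratio_lollipop_le {q : ℝ} (hq0 : 0 < q) (hq1 : q < 1) {n₁ n₂ : ℕ} (h₁ : 0 < n₁)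
    (h₂ : 2 ≤ n₂) (r : Fin (n₁ + n₂)) (hr : (r : ℕ) = 0) :
    1 - (∑ a : Arc (lollipop n₁ n₂), prob (G := lollipop n₁ n₂) (fun _ => q) (AllThrough r a.src ∅)
        / prob (G := lollipop n₁ n₂) (fun _ => q) (Meets r ∅))
        / (q * (Nat.card (Arc (lollipop n₁ n₂)) : ℝ) * ((n₁ + n₂ : ℕ) : ℝ) / (1 - q))
      ≤ 2 * n₁ / ((n₂ : ℝ) * (n₂ - 1)) + n₂ / n₁
        + (n₂ : ℝ) ^ 2 * (1 - (1 - q) ^ 2) ^ (n₂ - 2) := by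
  have hp : UnitRange fun _ : Arc (lollipop n₁ n₂) => q := fun _ => ⟨hq0.le, hq1.le⟩
  have hZ : 0 < prob (G := lollipop n₁ n₂) (fun _ => q) (Meets r ∅) :=
    prob_meets_pos isBidirected_lollipop (connected_lollipop (by omega)) fun _ => ⟨hq0.le, hq1⟩
  have hn₁ : (0 : ℝ) < n₁ := by exact_mod_cast h₁
  have hn₂ : (2 : ℝ) ≤ n₂ := by exact_mod_cast h₂
  have h1q : 0 < 1 - q := by linarith
  set P := prob (G := lollipop n₁ n₂) (fun _ => q) TwoStepClique with hP
  have hP1 : P ≤ 1 := prob_le_one hp _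
  have hP0 : 1 - P ≤ (n₂ : ℝ) ^ 2 * (1 - (1 - q) ^ 2) ^ (n₂ - 2) := by
    linarith [le_prob_twoStepClique (n₁ := n₁) (n₂ := n₂) (q := q) ⟨hq0.le, hq1.le⟩]
  set K : ℝ := ∑ a : Arc (lollipop n₁ n₂), ind (n₁ ≤ (a.src : ℕ)) with hK
  have hK0 : 0 ≤ K := Finset.sum_nonneg fun a _ => ind_nonneg _
  set m : ℝ := (Nat.card (Arc (lollipop n₁ n₂)) : ℝ) with hm
  have hKm : m - 2 * n₁ ≤ K ∧ K ≤ m := by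
    have h3 : K + ∑ a : Arc (lollipop n₁ n₂), ind (¬ n₁ ≤ (a.src : ℕ)) = m := by
      rw [hK, ← Finset.sum_add_distrib, hm, Nat.card_eq_fintype_card, ← Finset.card_univ,
        Finset.card_eq_sum_ones]
      push_cast
      exact Finset.sum_congr rfl fun a _ => by rw [ind_not]; ring
    have h4 := sum_path_arcs_le (n₁ := n₁) (n₂ := n₂)
    have h5 : 0 ≤ ∑ a : Arc (lollipop n₁ n₂), ind (¬ n₁ ≤ (a.src : ℕ)) :=
      Finset.sum_nonneg fun a _ => ind_nonneg _
    constructor <;> linarith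
  have hmge : (n₂ : ℝ) * (n₂ - 1) ≤ m := by
    have h3 := card_arc_lollipop_ge (n₁ := n₁) (n₂ := n₂)
    rw [← Nat.card_eq_fintype_card] at h3
    have h4 : ((n₂ * n₂ - n₂ : ℕ) : ℝ) ≤ m := Nat.cast_le.2 h3
    rw [Nat.cast_sub (Nat.le_mul_self n₂)] at h4
    push_cast at h4
    linarith
  have hpos : 0 < (n₂ : ℝ) * (n₂ - 1) := mul_pos (by linarith) (by linarith)
  have hm0 : 0 < m := lt_of_lt_of_le hpos hmge
  have hsum : K * (n₁ * (q / (1 - q)) * P) ≤ ∑ a : Arc (lollipop n₁ n₂),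
      prob (G := lollipop n₁ n₂) (fun _ => q) (AllThrough r a.src ∅)
        / prob (G := lollipop n₁ n₂) (fun _ => q) (Meets r ∅) := by
    rw [hK, Finset.sum_mul]
    refine Finset.sum_le_sum fun a _ => ?_
    by_cases ha : n₁ ≤ (a.src : ℕ)
    · rw [ind_of_true ha, one_mul]
      exact le_prob_allThrough_div hq0 hq1 (by omega) hr _ ha
    · rw [ind_of_false ha, zero_mul]
      exact div_nonneg (prob_nonneg hp _) hZ.le
  have hn : (0 : ℝ) < n₁ + n₂ := by linarith
  -- Three sources of loss: arcs with tail off the clique, vertices not on the path, and failure of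
  -- the two-step property.
  have hratio : K / m * (n₁ / (n₁ + n₂)) * P ≤ (∑ a : Arc (lollipop n₁ n₂),
      prob (G := lollipop n₁ n₂) (fun _ => q) (AllThrough r a.src ∅)
        / prob (G := lollipop n₁ n₂) (fun _ => q) (Meets r ∅))
        / (q * m * ((n₁ + n₂ : ℕ) : ℝ) / (1 - q)) := by
    push_cast
    rw [le_div_iff₀ (by positivity)]
    refine le_trans (le_of_eq ?_) hsum
    field_simp
  have hKm1 : 1 - K / m ≤ 2 * n₁ / ((n₂ : ℝ) * (n₂ - 1)) := by
    calc 1 - K / m = (m - K) / m := by field_simp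
      _ ≤ 2 * n₁ / m := by
        refine div_le_div_of_nonneg_right ?_ hm0.le
        linarith [hKm.1]
      _ ≤ _ := div_le_div_of_nonneg_left (by positivity) hpos hmge
  have hn1 : 1 - (n₁ : ℝ) / (n₁ + n₂) ≤ n₂ / n₁ := by
    calc 1 - (n₁ : ℝ) / (n₁ + n₂) = n₂ / (n₁ + n₂) := by field_simp; ring
      _ ≤ _ := div_le_div_of_nonneg_left (by linarith) hn₁ (by linarith)
  have := one_sub_mul_le (a := K / m) (b := n₁ / (n₁ + n₂)) (c := P) (by positivity)
    (by rw [div_le_one hm0]; exact hKm.2) (by positivity) (by rw [div_le_one hn]; linarith) hP1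
  linarith

lemma pathLength_pos (ε : ℝ) (k : ℕ) : 0 < pathLength ε (k + 1) :=
  Nat.ceil_pos.2 (Real.rpow_pos_of_pos (by positivity) _)

lemma tendsto_cast_succ : Tendsto (fun k : ℕ => ((k + 1 : ℕ) : ℝ)) atTop atTop :=
  tendsto_natCast_atTop_atTop.comp (tendsto_add_atTop_nat 1)

lemma tendsto_succ_div_pathLength {ε : ℝ} (hε : 0 < ε) :
    Tendsto (fun k : ℕ => ((k + 1 : ℕ) : ℝ) / pathLength ε (k + 1)) atTop (𝓝 0) := by
  refine squeeze_zero (fun k => by positivity) (fun k => ?_)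
    ((tendsto_rpow_neg_atTop hε).comp tendsto_cast_succ)
  have hN : (0 : ℝ) < ((k + 1 : ℕ) : ℝ) := by positivity
  have h1 : ((k + 1 : ℕ) : ℝ) ^ (1 + ε) ≤ pathLength ε (k + 1) := Nat.le_ceil _
  simp only [Function.comp_apply]
  rw [div_le_iff₀ (by exact_mod_cast pathLength_pos ε k)]
  calc ((k + 1 : ℕ) : ℝ) = ((k + 1 : ℕ) : ℝ) ^ (-ε) * ((k + 1 : ℕ) : ℝ) ^ (1 + ε) := by
        rw [← Real.rpow_add hN]
        simp
    _ ≤ _ := mul_le_mul_of_nonneg_left h1 (Real.rpow_nonneg hN.le _)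

lemma tendsto_pathLength_div {ε : ℝ} (hε0 : 0 < ε) (hε : ε < 1) :
    Tendsto (fun k : ℕ => 2 * (pathLength ε (k + 1) : ℝ)
      / (((k + 1 : ℕ) : ℝ) * (((k + 1 : ℕ) : ℝ) - 1))) atTop (𝓝 0) := by
  -- The constant is `2 * 2 * 2`: the factor in the statement, the rounding up of the path length,
  -- and `N * N ≤ 2 * (N * (N - 1))`.
  have h0 := ((tendsto_rpow_neg_atTop (sub_pos.2 hε)).comp tendsto_cast_succ).const_mul 8
  rw [mul_zero] at h0
  refine squeeze_zero' (Eventually.of_forall fun k => ?_) ?_ h0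
  · refine div_nonneg (by positivity) (mul_nonneg (by positivity) ?_)
    push_cast
    simp
  · filter_upwards [eventually_ge_atTop 1] with k hk
    have hk' : (1 : ℝ) ≤ k := by exact_mod_cast hk
    set N : ℝ := ((k + 1 : ℕ) : ℝ) with hN
    have hNk : N = k + 1 := by rw [hN]; push_cast; rfl
    have hN0 : 0 < N := by linarith
    have h1 : (pathLength ε (k + 1) : ℝ) ≤ 2 * N ^ (1 + ε) := by
      have h2 := (Nat.ceil_lt_add_one (Real.rpow_nonneg hN0.le (1 + ε))).le
      have h3 : 1 ≤ N ^ (1 + ε) := Real.one_le_rpow (by linarith) (by linarith)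
      have h4 : (pathLength ε (k + 1) : ℝ) ≤ N ^ (1 + ε) + 1 := h2
      linarith
    have h5 : N ^ (1 + ε) = N ^ (-(1 - ε)) * (N * N) := by
      rw [← sq, ← Real.rpow_two, ← Real.rpow_add hN0]
      congr 1
      ring
    have h6 : 0 < N ^ (-(1 - ε)) := Real.rpow_pos_of_pos hN0 _
    simp only [Function.comp_apply]
    rw [div_le_iff₀ (mul_pos hN0 (by linarith))]
    rw [h5] at h1
    have h7 : N * N ≤ 2 * (N * (N - 1)) := by nlinarith
    nlinarith [mul_le_mul_of_nonneg_left h7 h6.le]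

lemma tendsto_sq_mul_pow {c : ℝ} (hc0 : 0 < c) (hc1 : c < 1) :
    Tendsto (fun k : ℕ => ((k + 1 : ℕ) : ℝ) ^ 2 * c ^ (k + 1 - 2)) atTop (𝓝 0) := by
  have h := ((tendsto_pow_const_mul_const_pow_of_abs_lt_one 2
    (by rwa [abs_of_pos hc0] : |c| < 1)).comp (tendsto_add_atTop_nat 1)).div_const (c ^ 2)
  rw [zero_div] at h
  refine h.congr' ?_
  -- At `k = 0` the exponent `k + 1 - 2` is truncated, so the shift is valid only from `k = 1` on.
  filter_upwards [eventually_ge_atTop 1] with k hk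
  obtain ⟨j, rfl⟩ : ∃ j, k = j + 1 := ⟨k - 1, by omega⟩
  simp only [Function.comp_apply]
  rw [show j + 1 + 1 - 2 = j by omega, pow_add c (j + 1) 1, pow_succ c j]
  field_simp

/-- `η` is the exact relative defect `1 - Q / B` of the cost formula against the bound, so the
equality is automatic. The general upper bound gives `0 ≤ η`, and `one_sub_ratio_lollipop_le`
squeezes it to zero. -/
lemma exists_lollipop_defect {q ε : ℝ} (hq0 : 0 < q) (hq1 : q < 1) (hε0 : 0 < ε) (hε1 : ε < 1) :
    ∃ η : ℕ → ℝ, Tendsto η atTop (𝓝 0) ∧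
      ∀ (k : ℕ) (r : Fin (pathLength ε (k + 1) + (k + 1))), (r : ℕ) = 0 →
        expectedDraws (G := lollipop (pathLength ε (k + 1)) (k + 1)) r (fun _ => q) =
          ENNReal.ofReal
            ((Nat.card (Arc (lollipop (pathLength ε (k + 1)) (k + 1))) : ℝ)
              + (1 - η k) *
                (q * (Nat.card (Arc (lollipop (pathLength ε (k + 1)) (k + 1))) : ℝ)
                  * ((pathLength ε (k + 1) + (k + 1) : ℕ) : ℝ) / (1 - q))) := by
  have h1q : 0 < 1 - q := by linarith
  set root : ∀ k : ℕ, Fin (pathLength ε (k + 1) + (k + 1)) := fun k => ⟨0, by omega⟩ with hroot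
  set B : ℕ → ℝ := fun k => q * (Nat.card (Arc (lollipop (pathLength ε (k + 1)) (k + 1))) : ℝ)
    * ((pathLength ε (k + 1) + (k + 1) : ℕ) : ℝ) / (1 - q) with hB
  set Q : ℕ → ℝ := fun k => ∑ a : Arc (lollipop (pathLength ε (k + 1)) (k + 1)),
    prob (G := lollipop (pathLength ε (k + 1)) (k + 1)) (fun _ => q) (AllThrough (root k) a.src ∅)
      / prob (G := lollipop (pathLength ε (k + 1)) (k + 1)) (fun _ => q) (Meets (root k) ∅) with hQ
  have hBpos : ∀ k, 0 < B k := by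
    intro k
    have : Nonempty (Arc (lollipop (pathLength ε (k + 1)) (k + 1))) :=
      ⟨downArc k.succ_pos ⟨0, pathLength_pos ε k⟩⟩
    have h3 : (0 : ℝ) < Nat.card (Arc (lollipop (pathLength ε (k + 1)) (k + 1))) := by
      exact_mod_cast Nat.card_pos
    have h4 : (0 : ℝ) < ((pathLength ε (k + 1) + (k + 1) : ℕ) : ℝ) := by positivity
    rw [hB]
    positivity
  have hQB : ∀ k, Q k ≤ B k := by
    intro k
    have := sum_prob_allThrough_le (G := lollipop (pathLength ε (k + 1)) (k + 1)) (r := root k)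
      (p := fun _ => q) (q := q) isBidirected_lollipop (connected_lollipop k.succ_pos)
      (fun _ => hq0) (fun _ => le_rfl) hq1 (fun _ _ _ _ => rfl)
    rwa [Nat.card_eq_fintype_card (α := Fin _), Fintype.card_fin] at this
  refine ⟨fun k => 1 - Q k / B k, ?_, fun k r hr => ?_⟩
  · have hc : 0 < 1 - (1 - q) ^ 2 ∧ 1 - (1 - q) ^ 2 < 1 :=
      ⟨by nlinarith, by nlinarith [pow_pos h1q 2]⟩
    have hlim := ((tendsto_pathLength_div hε0 hε1).add (tendsto_succ_div_pathLength hε0)).add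
      (tendsto_sq_mul_pow hc.1 hc.2)
    rw [add_zero, add_zero] at hlim
    refine squeeze_zero' (Eventually.of_forall fun k => ?_) ?_ hlim
    · rw [sub_nonneg, div_le_one (hBpos k)]
      exact hQB k
    · filter_upwards [eventually_ge_atTop 1] with k hk
      exact one_sub_ratio_lollipop_le hq0 hq1 (pathLength_pos ε k) (by omega) (root k) rfl
  · obtain rfl : r = root k := Fin.ext hr
    rw [expectedDraws_eq (fun _ => ⟨hq0.le, hq1.le⟩)
      (prob_meets_pos isBidirected_lollipop (connected_lollipop k.succ_pos)
        fun _ => ⟨hq0.le, hq1⟩)]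
    congr 2
    change Q k = (1 - (1 - Q k / B k)) * B k
    rw [sub_sub_cancel, div_mul_cancel₀ _ (hBpos k).ne']

end Asymptotics

end

end ClusterPopping

open ClusterPopping in
theorem theorem3p2 :
    (∀ (V : Type*) [Finite V] (G : Digraph V) (r : V) (p : Arc G → ℝ) (pmax : ℝ),
      IsBidirected G →
      G.toSimpleGraphInclusive.Connected →
      (∀ a, 0 < p a) → (∀ a, p a ≤ pmax) → pmax < 1 →
      (∀ a b : Arc G, b.src = a.tgt → b.tgt = a.src → p b = p a) →
        (∀ᵐ ω ∂(drawMeasure p), ∃ S, Returns r ω S) ∧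
        (∀ S, drawMeasure p {ω | Returns r ω S} = ENNReal.ofReal (target r p S)) ∧
        expectedDraws r p ≤ ENNReal.ofReal
          ((Nat.card (Arc G) : ℝ)
            + pmax * (Nat.card (Arc G) : ℝ) * (Nat.card V : ℝ) / (1 - pmax))) ∧
    (∀ p ε : ℝ, 0 < p → p < 1 → 0 < ε → ε < 1 →
      ∃ η : ℕ → ℝ, Tendsto η atTop (𝓝 0) ∧
        ∀ (k : ℕ) (r : Fin (pathLength ε (k + 1) + (k + 1))), (r : ℕ) = 0 →
          expectedDraws (G := lollipop (pathLength ε (k + 1)) (k + 1)) r (fun _ => p) =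
            ENNReal.ofReal
              ((Nat.card (Arc (lollipop (pathLength ε (k + 1)) (k + 1))) : ℝ)
                + (1 - η k) *
                  (p * (Nat.card (Arc (lollipop (pathLength ε (k + 1)) (k + 1))) : ℝ)
                    * ((pathLength ε (k + 1) + (k + 1) : ℕ) : ℝ) / (1 - p)))) := by
  refine ⟨fun V _ G r p q hG hconn hp0 hpq hq hsymm => ?_,
    fun p ε hp0 hp1 hε0 hε1 => exists_lollipop_defect hp0 hp1 hε0 hε1⟩
  cases nonempty_fintype V
  have hp : UnitRange p := fun a => ⟨(hp0 a).le, (hpq a).trans hq.le⟩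
  have hZ : 0 < prob p (Meets r ∅) :=
    prob_meets_pos hG hconn fun a => ⟨(hp0 a).le, (hpq a).trans_lt hq⟩
  refine ⟨ae_returns hp hZ, fun S => ?_, ?_⟩
  · rw [drawMeasure_returns hp hZ, target_eq]
  · rw [expectedDraws_eq hp hZ]
    exact ENNReal.ofReal_le_ofReal
      (add_le_add_right (sum_prob_allThrough_le hG hconn hp0 hpq hq hsymm) _)
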